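/- Let $\mathfrak g$ be a finite-dimensional complex simple Lie algebra of type $X_l$ with Cartan matrix $A_{ij}=2(\alpha_i|\alpha_j)/(\alpha_i|\alpha_i)$, where the form is normalized so that long roots have square length $2$; put $d_i=(\alpha_i|\alpha_i)/2$. Let $h\in\mathbb C$ be such that $q=e^{h}$ is not a root of unity, write $q^x=e^{xh}$ for $x\in\mathbb Q$, $q_i=q^{d_i}$, $[x]=(q^x-q^{-x})/(q-q^{-1})$, and let $\left[{N\atop s}\right]_i$ be the $q_i$-binomial coefficients. Let $U_q(\widehat{\mathfrak g})$ be the quantum affine algebra of the untwisted type $X_l^{(1)}$ in Drinfeld's realization: the associative $\mathbb C$-algebra generated by $\gamma^{\pm1/2}$ (central), $k_i^{\pm1}$, $d$, $a_i(n)$ ($n\neq0$), $x_i^{\pm}(n)$ ($n\in\mathbb Z$), $1\le i\le l$, with the relations $$[k_i,k_j]=[k_i,d]=[k_i,a_j(n)]=0,\quad k_ix_j^\pm(n)k_i^{-1}=q^{\pm(\alpha_i|\alpha_j)}x_j^\pm(n),\quad [d,a_i(n)]=na_i(n),\quad [d,x_i^\pm(n)]=nx_i^\pm(n),$$ $$[a_i(m),a_j(n)]=\delta_{m,-n}\frac{[(\alpha_i|\alpha_j)m]}{m}\,\frac{\gamma^m-\gamma^{-m}}{q-q^{-1}},\qquad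 [a_i(m),x_j^\pm(n)]=\pm\frac{[(\alpha_i|\alpha_j)m]}{m}\gamma^{\mp|m|/2}x_j^\pm(m+n),$$ $$(z-q^{\pm(\alpha_i|\alpha_j)}w)\,x_i^\pm(z)x_j^\pm(w)=(q^{\pm(\alpha_i|\alpha_j)}z-w)\,x_j^\pm(w)x_i^\pm(z),$$ $$[x_i^+(m),x_j^-(n)]=\frac{\delta_{ij}}{q_i-q_i^{-1}}\bigl(\gamma^{(m-n)/2}\psi_i(m+n)-\gamma^{(n-m)/2}\phi_i(m+n)\bigr),$$ $$\mathrm{Sym}_{m_1,\dots,m_N}\sum_{s=0}^{N}(-1)^s\left[{N\atop s}\right]_i x_i^\pm(m_1)\cdots x_i^\pm(m_s)\,x_j^\pm(n)\,x_i^\pm(m_{s+1})\cdots x_i^\pm(m_N)=0\qquad(i\ne j,\ N=1-A_{ij}),$$ where $x_i^\pm(z)=\sum_n x_i^\pm(n)z^{-n}$, $\sum_{n\ge0}\psi_i(n)z^{-n}=k_i\exp\bigl((q-q^{-1})\sum_{n>0}a_i(n)z^{-n}\bigr)$, $\sum_{n\ge0}\phi_i(-n)z^{n}=k_i^{-1}\exp\bigl((q^{-1}-q)\sum_{n>0}a_i(-n)z^{n}\bigr)$,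 and $\psi_i(n)=\phi_i(-n)=0$ for $n<0$. Let $k\in\mathbb Q$, $k\neq0$, and let $V$ be a $U_q(\widehat{\mathfrak g})$-module such that: (1) $V$ has level $k$, that is, $\gamma^{1/2}$ acts as $q^{k/2}$ (so $\gamma$ acts as $q^k$); (2) $V=\bigoplus_{a\in\mathbb C}V_a$, where $V_a=\{v: d\,v=av\}$, and the weight spaces (simultaneous eigenspaces of $d,k_1,\dots,k_l$) are finite-dimensional; (3) for each $a\in\mathbb C$ there is $n_0\ge 0$ such that $V_{a+n}=0$ for all integers $n>n_0$. On $V$ define $$E_-^{\pm}(\alpha_i,z)=\exp\Bigl(\mp\sum_{n\ge1}\frac{q^{\mp kn/2}}{[kn]}a_i(-n)z^n\Bigr),\qquad E_+^{\pm}(\alpha_i,z)=\exp\Bigl(\pm\sum_{n\ge1}\frac{q^{\mp kn/2}}{[kn]}a_i(n)z^{-n}\Bigr),$$ let $E_+^\pm(-\alpha_i,z)$ be given by the latter formula with $-a_i(n)$ in place of $a_i(n)$, and define the quantum $Z$-operators $Z_i^\pm(n)$ ($n\in\mathbb Z$) by $$Z^\pm(\alpha_i,z)=E_-^\pm(\alpha_i,z)\,x_i^\pm(z)\,E_+^\pm(\alpha_i,z)=\sum_{n\in\mathbb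 Z}Z_i^\pm(n)z^{-n}.$$ The vacuum space is $\Omega_V=\{v\in V: E_+^\pm(\alpha_i,z)v=E_+^\pm(-\alpha_i,z)v=v\ \text{ for all } i\}$. Then the operators $Z_i^\pm(n)$ are well defined (applied to any vector, the sum of products of coefficients that defines $Z_i^\pm(n)$ has only finitely many nonzero terms), they map $\Omega_V$ into itself, and $V$ is an irreducible $U_q(\widehat{\mathfrak g})$-module if and only if $\Omega_V$ is irreducible under the quantum $Z$-operators, that is, $\Omega_V\neq0$ and the only subspaces of $\Omega_V$ stable under all $Z_i^\pm(n)$ are $0$ and $\Omega_V$. -/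

import Mathlib

namespace QuantumZ

noncomputable section

/-! ### Finite type data -/

/-- The finite types `X_l` for which `X_l^{(1)}` is an untwisted affine type. -/
inductive DynkinType : Type
  | A (l : ℕ) (hl : 1 ≤ l)
  | B (l : ℕ) (hl : 3 ≤ l)
  | C (l : ℕ) (hl : 2 ≤ l)
  | D (l : ℕ) (hl : 4 ≤ l)
  | E6
  | E7
  | E8
  | F4
  | G2

/-- The rank `l` of the simple Lie algebra. -/
def DynkinType.rank : DynkinType → ℕ
  | .A l _ => l
  | .B l _ => l
  | .C l _ => l
  | .D l _ => l
  | .E6 => 6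
  | .E7 => 7
  | .E8 => 8
  | .F4 => 4
  | .G2 => 2

/-- The Cartan matrix `A_{ij} = 2 (α_i|α_j) / (α_i|α_i)`.  Mathlib's Cartan matrices follow the
convention `2 (α_i|α_j) / (α_j|α_j)`, hence the transposes. -/
def DynkinType.cartan : (T : DynkinType) → Matrix (Fin T.rank) (Fin T.rank) ℤ
  | .A l _ => (CartanMatrix.A l).transpose
  | .B l _ => (CartanMatrix.B l).transpose
  | .C l _ => (CartanMatrix.C l).transpose
  | .D l _ => (CartanMatrix.D l).transpose
  | .E6 => CartanMatrix.E₆.transpose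
  | .E7 => CartanMatrix.E₇.transpose
  | .E8 => CartanMatrix.E₈.transpose
  | .F4 => CartanMatrix.F₄.transpose
  | .G2 => CartanMatrix.G₂.transpose

/-- The numbers `d_i = (α_i|α_i) / 2`, for the invariant form in which long roots have square
length `2`. -/
def DynkinType.halfSq : (T : DynkinType) → Fin T.rank → ℚ
  | .A _ _ => fun _ => 1
  | .B l _ => fun (i : Fin l) => if i.val + 1 = l then 1 / 2 else 1
  | .C l _ => fun (i : Fin l) => if i.val + 1 = l then 1 else 1 / 2
  | .D _ _ => fun _ => 1
  | .E6 => fun _ => 1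
  | .E7 => fun _ => 1
  | .E8 => fun _ => 1
  | .F4 => ![1, 1, 1 / 2, 1 / 2]
  | .G2 => ![1, 1 / 3]

/-- The invariant form on simple roots, `(α_i|α_j) = d_i A_{ij}`. -/
def DynkinType.form (T : DynkinType) (i j : Fin T.rank) : ℚ :=
  T.halfSq i * (T.cartan i j : ℚ)

/-! ### `q`-numbers.  Throughout `q = exp h`, so that all rational powers of `q` are determined. -/

/-- `q ^ x = exp (x h)`. -/
def qpow (h : ℂ) (x : ℚ) : ℂ := Complex.exp ((x : ℂ) * h)

/-- `[x] = (q ^ x - q ^ (-x)) / (q - q⁻¹)`. -/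
def qnum (h : ℂ) (x : ℚ) : ℂ := (qpow h x - qpow h (-x)) / (qpow h 1 - qpow h (-1))

/-- `[n]_i = (q_i ^ n - q_i ^ (-n)) / (q_i - q_i⁻¹)` with `q_i = q ^ c`. -/
def qint (h : ℂ) (c : ℚ) (n : ℕ) : ℂ :=
  (qpow h (c * n) - qpow h (-(c * n))) / (qpow h c - qpow h (-c))

/-- `[n]_i ! = [1]_i ⋯ [n]_i`. -/
def qfactorial (h : ℂ) (c : ℚ) (n : ℕ) : ℂ := ∏ r ∈ Finset.range n, qint h c (r + 1)

/-- The `q_i`-binomial coefficient, for `s ≤ N`. -/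
def qbinom (h : ℂ) (c : ℚ) (N s : ℕ) : ℂ :=
  qfactorial h c N / (qfactorial h c s * qfactorial h c (N - s))

/-! ### Exponentials of power series with noncommuting coefficients -/

/-- The formal exponential `∑_j f ^ j / j!` of a power series `f` without constant term, over a
possibly noncommutative algebra (so that `f ^ j` contributes to the `N`-th coefficient only when
`j ≤ N`). -/
def expSeries {R : Type*} [Ring R] [Algebra ℂ R] (f : PowerSeries R) : PowerSeries R :=
  PowerSeries.mk fun N =>
    ∑ j ∈ Finset.range (N + 1), ((j.factorial : ℂ)⁻¹) • PowerSeries.coeff N (f ^ j)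

/-! ### The quantum affine algebra in Drinfeld's realization -/

/-- The generators: `gh = γ^{1/2}`, its inverse, `k_i`, `k_i⁻¹`, the grading element `d`,
the `a_i(n)` with `n ≠ 0`, and the `x_i^ε(n)` with a sign `ε`. -/
inductive Gen (l : ℕ) : Type
  | gh : Gen l
  | ghInv : Gen l
  | k (i : Fin l) : Gen l
  | kInv (i : Fin l) : Gen l
  | d : Gen l
  | a (i : Fin l) (n : ℤ) (hn : n ≠ 0) : Gen l
  | x (ε : ℤˣ) (i : Fin l) (n : ℤ) : Gen l

namespace Free

/-- The free algebra on the generators. -/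
abbrev Alg (l : ℕ) : Type := FreeAlgebra ℂ (Gen l)

variable {l : ℕ}

/-- A generator as an element of the free algebra. -/
abbrev g (y : Gen l) : Alg l := FreeAlgebra.ι ℂ y

/-- The integral powers `γ^{m/2}`. -/
def ghPow (m : ℤ) : Alg l := if 0 ≤ m then g .gh ^ m.toNat else g .ghInv ^ (-m).toNat

/-- `a_i(n)` for `n ≠ 0` (and `0` for `n = 0`, a value that plays no role). -/
def a (i : Fin l) (n : ℤ) : Alg l := if hn : n ≠ 0 then g (.a i n hn) else 0

/-- `x_i^ε(n)`. -/
abbrev x (ε : ℤˣ) (i : Fin l) (n : ℤ) : Alg l := g (.x ε i n)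

/-- `ψ_i(n)`, where
`∑_{n ≥ 0} ψ_i(n) z^{-n} = k_i exp ((q - q⁻¹) ∑_{n > 0} a_i(n) z^{-n})`, and `ψ_i(n) = 0` for
`n < 0`. -/
def psi (h : ℂ) (i : Fin l) (n : ℤ) : Alg l :=
  if 0 ≤ n then
    g (.k i) * PowerSeries.coeff n.toNat (expSeries (PowerSeries.mk fun r : ℕ =>
      if r = 0 then 0 else (qpow h 1 - qpow h (-1)) • a i (r : ℤ)))
  else 0

/-- `φ_i(n)`, where
`∑_{n ≥ 0} φ_i(-n) z^n = k_i⁻¹ exp ((q⁻¹ - q) ∑_{n > 0} a_i(-n) z^n)`, and `φ_i(n) = 0` for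
`n > 0`. -/
def phi (h : ℂ) (i : Fin l) (n : ℤ) : Alg l :=
  if n ≤ 0 then
    g (.kInv i) * PowerSeries.coeff (-n).toNat (expSeries (PowerSeries.mk fun r : ℕ =>
      if r = 0 then 0 else (qpow h (-1) - qpow h 1) • a i (-(r : ℤ))))
  else 0

end Free

open Free in
/-- The defining relations of the quantum affine algebra, in components. -/
inductive Rel (T : DynkinType) (h : ℂ) : Alg T.rank → Alg T.rank → Prop
  | gh_mul_inv : Rel T h (g .gh * g .ghInv) 1
  | inv_mul_gh : Rel T h (g .ghInv * g .gh) 1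
  | gh_central (y : Gen T.rank) : Rel T h (g .gh * g y) (g y * g .gh)
  | k_mul_inv (i : Fin T.rank) : Rel T h (g (.k i) * g (.kInv i)) 1
  | inv_mul_k (i : Fin T.rank) : Rel T h (g (.kInv i) * g (.k i)) 1
  | k_k (i j : Fin T.rank) : Rel T h (g (.k i) * g (.k j)) (g (.k j) * g (.k i))
  | k_d (i : Fin T.rank) : Rel T h (g (.k i) * g .d) (g .d * g (.k i))
  | k_a (i j : Fin T.rank) (n : ℤ) (hn : n ≠ 0) :
      Rel T h (g (.k i) * a j n) (a j n * g (.k i))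
  | k_x (ε : ℤˣ) (i j : Fin T.rank) (n : ℤ) :
      Rel T h (g (.k i) * x ε j n)
        (qpow h (((ε : ℤ) : ℚ) * T.form i j) • (x ε j n * g (.k i)))
  | d_a (i : Fin T.rank) (n : ℤ) (hn : n ≠ 0) :
      Rel T h (g .d * a i n - a i n * g .d) ((n : ℂ) • a i n)
  | d_x (ε : ℤˣ) (i : Fin T.rank) (n : ℤ) :
      Rel T h (g .d * x ε i n - x ε i n * g .d) ((n : ℂ) • x ε i n)
  /-- `[a_i(m), a_j(n)] = δ_{m,-n} [(α_i|α_j) m] / m * (γ^m - γ^{-m}) / (q - q⁻¹)` -/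
  | a_a (i j : Fin T.rank) (m n : ℤ) (hm : m ≠ 0) (hn : n ≠ 0) :
      Rel T h (a i m * a j n - a j n * a i m)
        (if m + n = 0 then
          (qnum h (T.form i j * m) / (m : ℂ) / (qpow h 1 - qpow h (-1))) •
            (ghPow (2 * m) - ghPow (-(2 * m)))
        else 0)
  /-- `[a_i(m), x_j^±(n)] = ± [(α_i|α_j) m] / m * γ^{∓|m|/2} x_j^±(m + n)` -/
  | a_x (ε : ℤˣ) (i j : Fin T.rank) (m n : ℤ) (hm : m ≠ 0) :
      Rel T h (a i m * x ε j n - x ε j n * a i m)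
        ((((ε : ℤ) : ℂ) * (qnum h (T.form i j * m) / (m : ℂ))) •
          (ghPow (-((ε : ℤ) * |m|)) * x ε j (m + n)))
  /-- `(z - q^{±(α_i|α_j)} w) x_i^±(z) x_j^±(w) = (q^{±(α_i|α_j)} z - w) x_j^±(w) x_i^±(z)` -/
  | x_x (ε : ℤˣ) (i j : Fin T.rank) (m n : ℤ) :
      Rel T h
        (x ε i (m + 1) * x ε j n
          - qpow h (((ε : ℤ) : ℚ) * T.form i j) • (x ε i m * x ε j (n + 1)))
        (qpow h (((ε : ℤ) : ℚ) * T.form i j) • (x ε j n * x ε i (m + 1))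
          - x ε j (n + 1) * x ε i m)
  /-- `[x_i^+(m), x_j^-(n)] = δ_{ij} / (q_i - q_i⁻¹) *
  (γ^{(m-n)/2} ψ_i(m+n) - γ^{(n-m)/2} φ_i(m+n))` -/
  | xp_xm (i j : Fin T.rank) (m n : ℤ) :
      Rel T h (x 1 i m * x (-1) j n - x (-1) j n * x 1 i m)
        (if i = j then
          (qpow h (T.halfSq i) - qpow h (-(T.halfSq i)))⁻¹ •
            (ghPow (m - n) * psi h i (m + n) - ghPow (n - m) * phi h i (m + n))
        else 0)
  /-- The Serre relations: for `i ≠ j`, `N = 1 - A_{ij}`,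
  `Sym_{m_1, …, m_N} ∑_s (-1)^s [N choose s]_i
    x_i^±(m_1) ⋯ x_i^±(m_s) x_j^±(n) x_i^±(m_{s+1}) ⋯ x_i^±(m_N) = 0` -/
  | serre (ε : ℤˣ) (i j : Fin T.rank) (hij : i ≠ j) (N : ℕ) (hN : (N : ℤ) = 1 - T.cartan i j)
      (m : Fin N → ℤ) (n : ℤ) :
      Rel T h
        (∑ σ : Equiv.Perm (Fin N), ∑ s ∈ Finset.range (N + 1),
          ((-1 : ℂ) ^ s * qbinom h (T.halfSq i) N s) •
            (((List.ofFn fun t => x ε i (m (σ t))).take s).prod * x ε j n *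
              ((List.ofFn fun t => x ε i (m (σ t))).drop s).prod))
        0

/-- The quantum affine algebra `U_q(ĝ)` of untwisted type, `q = exp h`. -/
abbrev Uq (T : DynkinType) (h : ℂ) : Type := RingQuot (Rel T h)

/-- The canonical projection from the free algebra. -/
def Uq.mk (T : DynkinType) (h : ℂ) : FreeAlgebra ℂ (Gen T.rank) →ₐ[ℂ] Uq T h :=
  RingQuot.mkAlgHom ℂ (Rel T h)

section Modules

variable (T : DynkinType) (h : ℂ) (k : ℚ) (V : Type*) [AddCommGroup V] [Module ℂ V]
  [Module (Uq T h) V] [IsScalarTower ℂ (Uq T h) V]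

/-- The operator on `V` by which (the class of) an element of the free algebra acts. -/
def op (u : FreeAlgebra ℂ (Gen T.rank)) : Module.End ℂ V :=
  Algebra.lsmul ℂ ℂ V (Uq.mk T h u)

/-- The operator `d` on `V`; the homogeneous subspaces `V_a` are its eigenspaces. -/
def dOp : Module.End ℂ V := op T h V (Free.g .d)

/-- The operator `k_i` on `V`. -/
def kOp (i : Fin T.rank) : Module.End ℂ V := op T h V (Free.g (.k i))

/-- The operator `a_i(n)` on `V`. -/
def aOp (i : Fin T.rank) (n : ℤ) : Module.End ℂ V := op T h V (Free.a i n)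

/-- The operator `x_i^ε(n)` on `V`. -/
def xOp (ε : ℤˣ) (i : Fin T.rank) (n : ℤ) : Module.End ℂ V := op T h V (Free.x ε i n)

/-- The category of `U_q(ĝ)`-modules of level `k` under consideration. -/
structure InCategory : Prop where
  /-- `γ = q^c` acts as `q^k`, with square root `γ^{1/2} = q^{c/2}` acting as `q^{k/2}`. -/
  level : op T h V (Free.g .gh) = qpow h (k / 2) • (1 : Module.End ℂ V)
  /-- `V` is the sum (automatically direct) of its homogeneous subspaces `V_a`. -/
  graded : (⨆ a : ℂ, (dOp T h V).eigenspace a) = ⊤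
  /-- The weight spaces (simultaneous eigenspaces of `d` and all `k_i`) are finite dimensional. -/
  finite_weight : ∀ (a : ℂ) (κ : Fin T.rank → ℂ), FiniteDimensional ℂ
    ((dOp T h V).eigenspace a ⊓ ⨅ i, (kOp T h V i).eigenspace (κ i) : Submodule ℂ V)
  /-- For each `a` the degrees `a + n` that occur are bounded above. -/
  truncated : ∀ a : ℂ, ∃ n₀ : ℕ, ∀ n : ℕ, n₀ < n → (dOp T h V).eigenspace (a + n) = ⊥

/-- `E_+^ε(η α_i, z) = exp (ε ∑_{n ≥ 1} q^{-ε k n / 2} / [k n] * (η a_i(n)) z^{-n})`, as a power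
series in `z⁻¹`; here `ε` and `η` are signs. -/
def EPlus (ε η : ℤˣ) (i : Fin T.rank) : PowerSeries (Module.End ℂ V) :=
  expSeries (PowerSeries.mk fun n : ℕ => if n = 0 then 0 else
    (((ε : ℤ) : ℂ) * ((η : ℤ) : ℂ) *
      (qpow h (-(((ε : ℤ) : ℚ) * k * n / 2)) / qnum h (k * n))) • aOp T h V i (n : ℤ))

/-- `E_-^ε(α_i, z) = exp (- ε ∑_{n ≥ 1} q^{-ε k n / 2} / [k n] * a_i(-n) z^n)`, as a power
series in `z`. -/
def EMinus (ε : ℤˣ) (i : Fin T.rank) : PowerSeries (Module.End ℂ V) :=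
  expSeries (PowerSeries.mk fun n : ℕ => if n = 0 then 0 else
    (-((ε : ℤ) : ℂ) *
      (qpow h (-(((ε : ℤ) : ℚ) * k * n / 2)) / qnum h (k * n))) • aOp T h V i (-(n : ℤ)))

variable {V} in
/-- The summand of `Z_i^ε(n) v` indexed by `(p, r)`: the coefficient of `z^p` in
`E_-^ε(α_i, z)`, times `x_i^ε(n + p - r)`, times the coefficient of `z^{-r}` in
`E_+^ε(α_i, z)`, applied to `v`. -/
def ZTerm (ε : ℤˣ) (i : Fin T.rank) (n : ℤ) (v : V) (pr : ℕ × ℕ) : V :=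
  PowerSeries.coeff pr.1 (EMinus T h k V ε i)
    (xOp T h V ε i (n + pr.1 - pr.2)
      (PowerSeries.coeff pr.2 (EPlus T h k V ε 1 i) v))

variable {V} in
/-- The quantum `Z`-operators: `Z_i^ε(n)` is the coefficient of `z^{-n}` in
`E_-^ε(α_i, z) x_i^ε(z) E_+^ε(α_i, z)`, where `x_i^ε(z) = ∑ x_i^ε(m) z^{-m}`.  For modules in
the category the sum has only finitely many nonzero terms. -/
def ZOp (ε : ℤˣ) (i : Fin T.rank) (n : ℤ) (v : V) : V :=
  ∑ᶠ pr : ℕ × ℕ, ZTerm T h k ε i n v pr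

/-- The vacuum space: all `v` with `E_+^±(α_i, z) v = v` and `E_+^±(-α_i, z) v = v`, for all
`i`. -/
def vacuum : Submodule ℂ V where
  carrier := {v | ∀ (ε η : ℤˣ) (i : Fin T.rank) (N : ℕ),
    PowerSeries.coeff N (EPlus T h k V ε η i) v = if N = 0 then v else 0}
  add_mem' := by
    intro v w hv hw ε η i N
    rw [map_add, hv ε η i N, hw ε η i N]
    split_ifs <;> simp
  zero_mem' := by
    intro ε η i N
    simp
  smul_mem' := by
    intro c v hv ε η i N
    rw [map_smul, hv ε η i N]
    split_ifs <;> simp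

/-- A subspace is stable under all quantum `Z`-operators. -/
def ZStable (W : Submodule ℂ V) : Prop :=
  ∀ (ε : ℤˣ) (i : Fin T.rank) (n : ℤ), ∀ w ∈ W, ZOp T h k ε i n w ∈ W

/-- A subspace `Ω` is irreducible under the quantum `Z`-operators: it is nonzero and stable, and
its only stable subspaces are `0` and `Ω`. -/
structure ZIrreducible (Ω : Submodule ℂ V) : Prop where
  stable : ZStable T h k V Ω
  ne_bot : Ω ≠ ⊥
  eq_bot_or_eq : ∀ W : Submodule ℂ V, W ≤ Ω → ZStable T h k V W → W = ⊥ ∨ W = Ω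

end Modules

end

end QuantumZ

namespace QuantumZ

noncomputable section

/-! ### Exponential series over a noncommutative algebra -/

section ExpSeries

variable {R : Type*} [Ring R]

/-! At level `k ≠ 0` the operators `a_i(n)` form a Heisenberg algebra. Its pairing in degree `m` is
a nonzero multiple of the matrix `[(α_i|α_j) m]`, a `q`-deformed symmetrized Cartan matrix. This
matrix is invertible because `q` is not a root of unity (`eq_zero_of_form`, checked type by type,
and `isUnit_det_heisenbergForm`). Since degrees are bounded above along each coset of the integers,
`V` looks like a Fock space tensored with the vacuum space `Ω`. Two consequences suffice: a subspace
that contains `Ω` and is stable under creation operators is `V` (`eq_top_of_vacuumOf_le`), and `Ω`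
meets the sum of the images of the creation operators only in `0`
(`eq_zero_of_mem_vacuumOf_of_mem_creationRange`). Both come from the spectrum of truncated number
operators: eigenvalues are natural numbers, and `0` belongs to the vacuum.

The exponentials in `Z = E₋ x E₊` are chosen so that their commutators with `a_j(n)` cancel that of
`x`. Hence the `Z`-operators commute with the whole Heisenberg algebra (`aOp_pos_zOp`,
`aOp_neg_zOp`) and preserve `Ω`. Conversely `x` is recovered from `Z` by a triangular induction on
degrees (`mem_stabSub_of_dressSum_mem`).

If `Ω` is irreducible and `N` is a nonzero submodule, a vector of `N` of minimal filtration index is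
a vacuum vector, so `N ∩ Ω` is nonzero and `Z`-stable; hence `N` contains `Ω` and equals `V`. If `V`
is irreducible and `W ⊆ Ω` is nonzero and `Z`-stable, the span `S` of creation monomials applied to
`W` is stable under annihilators and the `Z`-operators, hence under all `x_i^±(n)`, hence under
`k_i^{±1}` through the relation for `[x⁺, x⁻]`. It need not be stable under `d`, because `W` need
not be graded; `eq_top_of_stable_of_graded` shows that irreducibility survives the omission of `d`.
So `S = V`, and comparing modulo the creation range gives `W = Ω`. -/

theorem coeff_pow_eq_zero_of_lt {f : PowerSeries R} (h0 : PowerSeries.coeff 0 f = 0) {j N : ℕ}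
    (h : N < j) : PowerSeries.coeff N (f ^ j) = 0 := by
  induction j generalizing N with
  | zero => omega
  | succ j ih =>
    rw [pow_succ, PowerSeries.coeff_mul]
    refine Finset.sum_eq_zero fun p hp => ?_
    have := Finset.HasAntidiagonal.mem_antidiagonal.mp hp
    by_cases hp2 : p.2 = 0
    · rw [hp2, h0, mul_zero]
    · rw [ih (by omega), zero_mul]

variable [Algebra ℂ R]

/-- The family `A` is left abstract so that one induction serves for operators of a given degree,
for stabilizers of a subspace (a constant family), and for operators that kill a fixed vacuum vector
in positive degree. -/
theorem coeff_pow_mem_of_graded {A : ℕ → Submodule ℂ R} (h1 : (1 : R) ∈ A 0)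
    (hmul : ∀ {m n : ℕ} {a b : R}, a ∈ A m → b ∈ A n → a * b ∈ A (m + n))
    {f : PowerSeries R} (hf : ∀ n, PowerSeries.coeff n f ∈ A n) (j N : ℕ) :
    PowerSeries.coeff N (f ^ j) ∈ A N := by
  induction j generalizing N with
  | zero =>
    rw [pow_zero, PowerSeries.coeff_one]
    split_ifs with h
    · rwa [h]
    · exact zero_mem _
  | succ j ih =>
    rw [pow_succ, PowerSeries.coeff_mul]
    refine sum_mem fun p hp => ?_
    rw [← Finset.HasAntidiagonal.mem_antidiagonal.mp hp]
    exact hmul (ih _) (hf _)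

theorem coeff_expSeries_mem_of_graded {A : ℕ → Submodule ℂ R} (h1 : (1 : R) ∈ A 0)
    (hmul : ∀ {m n : ℕ} {a b : R}, a ∈ A m → b ∈ A n → a * b ∈ A (m + n))
    {f : PowerSeries R} (hf : ∀ n, PowerSeries.coeff n f ∈ A n) (N : ℕ) :
    PowerSeries.coeff N (expSeries f) ∈ A N := by
  rw [expSeries, PowerSeries.coeff_mk]
  exact sum_mem fun j _ => Submodule.smul_mem _ _ (coeff_pow_mem_of_graded h1 hmul hf j N)

@[simp] theorem coeff_zero_expSeries (f : PowerSeries R) :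
    PowerSeries.coeff 0 (expSeries f) = 1 := by
  simp [expSeries]

/-- By the Leibniz rule the commutator has `j + 1` contributions, all equal since `D` moves freely
past `f`. -/
theorem commutator_pow_succ {a f D : R} (h : a * f - f * a = D) (hD : Commute D f) (j : ℕ) :
    a * f ^ (j + 1) - f ^ (j + 1) * a = ((j : ℂ) + 1) • (D * f ^ j) := by
  induction j with
  | zero => simp [h]
  | succ j ih =>
    have e : a * f ^ (j + 1 + 1) - f ^ (j + 1 + 1) * a
        = (a * f ^ (j + 1) - f ^ (j + 1) * a) * f + f ^ (j + 1) * (a * f - f * a) := by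
      rw [pow_succ f (j + 1)]; noncomm_ring
    rw [e, ih, h, smul_mul_assoc, mul_assoc, ← pow_succ, ← (hD.pow_right (j + 1)).eq]
    push_cast
    rw [add_smul ((j : ℂ) + 1) 1, one_smul]

/-- If `A` commutes with the coefficients of `f` up to a scalar in degree `m`, then it acts on the
exponential of `f` as a derivation. -/
theorem commutator_coeff_expSeries {A : R} {c : ℂ} {m : ℕ} {f : PowerSeries R}
    (h0 : PowerSeries.coeff 0 f = 0) (hm : 0 < m)
    (hf : ∀ n, A * PowerSeries.coeff n f - PowerSeries.coeff n f * A
      = if n = m then c • (1 : R) else 0) (N : ℕ) :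
    A * PowerSeries.coeff N (expSeries f) - PowerSeries.coeff N (expSeries f) * A
      = if m ≤ N then c • PowerSeries.coeff (N - m) (expSeries f) else 0 := by
  -- With `A` viewed as a constant series, its commutator with `f` is a scalar multiple of `X ^ m`,
  -- which commutes with `f`; the power rule then applies.
  have hC : PowerSeries.C A * f - f * PowerSeries.C A
      = c • (PowerSeries.X ^ m : PowerSeries R) := by
    ext n
    rw [map_sub, PowerSeries.coeff_C_mul, PowerSeries.coeff_mul_C, hf, PowerSeries.coeff_smul,
      PowerSeries.coeff_X_pow]
    split_ifs <;> simp
  have hcomm : Commute (c • (PowerSeries.X ^ m : PowerSeries R)) f :=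
    ((PowerSeries.commute_X_pow f m).symm).smul_left c
  have hpow : ∀ j : ℕ, A * PowerSeries.coeff N (f ^ (j + 1)) - PowerSeries.coeff N (f ^ (j + 1)) * A
      = if m ≤ N then (((j : ℂ) + 1) * c) • PowerSeries.coeff (N - m) (f ^ j) else 0 := by
    intro j
    have := congrArg (PowerSeries.coeff N) (commutator_pow_succ hC hcomm j)
    rw [map_sub, PowerSeries.coeff_C_mul, PowerSeries.coeff_mul_C] at this
    rw [this, smul_mul_assoc, smul_smul, PowerSeries.coeff_smul, PowerSeries.coeff_X_pow_mul']
    split_ifs <;> simp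
  simp only [expSeries, PowerSeries.coeff_mk, Finset.mul_sum, Finset.sum_mul, mul_smul_comm,
    smul_mul_assoc, ← Finset.sum_sub_distrib, ← smul_sub]
  rw [Finset.sum_range_succ']
  simp only [hpow, pow_zero]
  have e0 : A * PowerSeries.coeff N (1 : PowerSeries R) - PowerSeries.coeff N 1 * A = 0 := by
    rw [PowerSeries.coeff_one]; split_ifs <;> simp
  rw [e0, smul_zero, add_zero]
  split_ifs with hmN
  · rw [Finset.smul_sum]
    -- The factor `j + 1` turns `1/(j+1)!` into `1/j!`. The surplus terms `j > N - m` vanish because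
    -- `f ^ j` starts in degree `j`.
    have hsub : Finset.range (N - m + 1) ⊆ Finset.range N :=
      Finset.range_subset_range.mpr (by omega)
    rw [← Finset.sum_subset hsub]
    · refine Finset.sum_congr rfl fun j _ => ?_
      rw [smul_smul, smul_smul, Nat.factorial_succ]
      congr 1
      have : ((j : ℂ) + 1) ≠ 0 := by exact_mod_cast Nat.succ_ne_zero j
      have : ((j.factorial : ℂ)) ≠ 0 := by exact_mod_cast j.factorial_ne_zero
      push_cast
      field_simp
    · intro j _ hj
      rw [Finset.mem_range, not_lt] at hj
      rw [coeff_pow_eq_zero_of_lt h0 (by omega), smul_zero, smul_zero]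
  · simp

end ExpSeries

/-! ### Separated exhaustive filtrations and operators of a given degree -/

section Filtration

variable {V : Type*} [AddCommGroup V] [Module ℂ V]

/-- An increasing exhaustive filtration that vanishes in nonpositive degrees.  The index measures
how far below the top degree a vector may reach. -/
structure IsTruncFiltration (F : ℤ → Submodule ℂ V) : Prop where
  mono : Monotone F
  eq_bot : ∀ M ≤ 0, F M = ⊥
  exhaust : ∀ v, ∃ M : ℕ, v ∈ F M

/-- Operators that raise the degree by `n`, hence lower the filtration index by `n`. -/
def degSub (F : ℤ → Submodule ℂ V) (n : ℤ) : Submodule ℂ (Module.End ℂ V) where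
  carrier := {f | ∀ M, ∀ v ∈ F M, f v ∈ F (M - n)}
  add_mem' hf hg M v hv := add_mem (hf M v hv) (hg M v hv)
  zero_mem' _ _ _ := zero_mem _
  smul_mem' c _ hf M v hv := Submodule.smul_mem _ c (hf M v hv)

/-- Operators that leave the subspace `S` stable. -/
def stabSub (S : Submodule ℂ V) : Submodule ℂ (Module.End ℂ V) where
  carrier := {f | ∀ v ∈ S, f v ∈ S}
  add_mem' hf hg v hv := add_mem (hf v hv) (hg v hv)
  zero_mem' _ _ := zero_mem _
  smul_mem' c _ hf v hv := Submodule.smul_mem _ c (hf v hv)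

variable {F : ℤ → Submodule ℂ V}

theorem one_mem_degSub : (1 : Module.End ℂ V) ∈ degSub F 0 := by
  intro M v hv
  simpa using hv

theorem mul_mem_degSub {m n : ℤ} {f g : Module.End ℂ V} (hf : f ∈ degSub F m)
    (hg : g ∈ degSub F n) : f * g ∈ degSub F (m + n) := by
  intro M v hv
  have := hf _ _ (hg _ _ hv)
  rwa [sub_sub, add_comm n m] at this

theorem IsTruncFiltration.eq_zero (hF : IsTruncFiltration F) {M : ℤ} (hM : M ≤ 0) {v : V}
    (hv : v ∈ F M) : v = 0 := by
  rw [hF.eq_bot M hM] at hv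
  exact hv

/-- A nonzero subspace contains a nonzero vector of minimal filtration index. -/
theorem IsTruncFiltration.exists_minimal (hF : IsTruncFiltration F) {S : Submodule ℂ V}
    (hS : S ≠ ⊥) : ∃ M : ℕ, ∃ v ∈ S, v ∈ F M ∧ v ≠ 0 ∧
      ∀ n : ℤ, 0 < n → ∀ w ∈ S, w ∈ F (M - n) → w = 0 := by
  classical
  have hex : ∃ M : ℕ, ∃ v ∈ S, v ∈ F M ∧ v ≠ 0 := by
    obtain ⟨v, hv, hv0⟩ := Submodule.exists_mem_ne_zero_of_ne_bot hS
    obtain ⟨M, hM⟩ := hF.exhaust v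
    exact ⟨M, v, hv, hM, hv0⟩
  obtain ⟨v, hv, hvM, hv0⟩ := Nat.find_spec hex
  refine ⟨Nat.find hex, v, hv, hvM, hv0, fun n hn w hw hwM => ?_⟩
  by_contra hw0
  by_cases hle : ((Nat.find hex : ℕ) : ℤ) - n ≤ 0
  · exact hw0 (hF.eq_zero hle hwM)
  · obtain ⟨t, ht⟩ := Int.eq_ofNat_of_zero_le (not_le.mp hle).le
    rw [ht] at hwM
    exact Nat.find_min hex (m := t) (by omega) ⟨w, hw, hwM, hw0⟩

end Filtration

/-! ### Normally ordered products `e⁻(z) x(z) e⁺(z)` -/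

theorem finsum_shift {α β V : Type*} [AddCommMonoid V] (e : α → β) (he : Function.Injective e)
    (f : β → V)
    (hf : ∀ b, b ∉ Set.range e → f b = 0) : ∑ᶠ b, f b = ∑ᶠ a, f (e a) := by
  rw [← finsum_mem_range (f := f) he, finsum_mem_def]
  refine finsum_congr fun b => ?_
  by_cases hb : b ∈ Set.range e
  · rw [Set.indicator_of_mem hb]
  · rw [Set.indicator_of_notMem hb, hf b hb]

section Dressing

variable {V : Type*} [AddCommGroup V] [Module ℂ V]

/-- The summand `e⁻_p x_{n+p-r} e⁺_r v` of the `n`-th coefficient of `e⁻(z) x(z) e⁺(z) v`. -/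
def dressTerm (em : ℕ → Module.End ℂ V) (x : ℤ → Module.End ℂ V) (ep : ℕ → Module.End ℂ V)
    (n : ℤ) (v : V) (pr : ℕ × ℕ) : V :=
  em pr.1 (x (n + pr.1 - pr.2) (ep pr.2 v))

variable {F : ℤ → Submodule ℂ V} {em ep : ℕ → Module.End ℂ V} {x : ℤ → Module.End ℂ V}

/-- For `v` of index `M`, the vector `e⁺_r v` vanishes once `r ≥ M`. The vector `x_{n+p-r} e⁺_r v`
has index `M - n - p` whatever `r` is, which bounds `p`; nothing about `e⁻` is needed. -/
theorem dressTerm_support_finite (hF : IsTruncFiltration F) (hx : ∀ n, x n ∈ degSub F n)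
    (hp : ∀ r : ℕ, ep r ∈ degSub F r) (n : ℤ) (v : V) :
    (Function.support (dressTerm em x ep n v)).Finite := by
  obtain ⟨M, hM⟩ := hF.exhaust v
  refine (Finset.finite_toSet (Finset.range (M - n).toNat ×ˢ Finset.range M)).subset ?_
  intro pr hpr
  by_contra hnot
  refine hpr ?_
  simp only [Finset.coe_product, Finset.coe_range, Set.mem_prod, Set.mem_Iio, not_and_or,
    not_lt] at hnot
  have h1 := hp pr.2 _ _ hM
  have h2 := hx (n + pr.1 - pr.2) _ _ h1
  have h3 : x (n + pr.1 - pr.2) (ep pr.2 v) = 0 := by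
    rcases hnot with h | h
    · exact hF.eq_zero (by omega) h2
    · rw [hF.eq_zero (by omega) h1, map_zero]
  rw [dressTerm, h3, map_zero]

/-- The `n`-th coefficient of `e⁻(z) x(z) e⁺(z) v`. -/
def dressSum (em : ℕ → Module.End ℂ V) (x : ℤ → Module.End ℂ V) (ep : ℕ → Module.End ℂ V)
    (n : ℤ) (v : V) : V :=
  ∑ᶠ pr : ℕ × ℕ, dressTerm em x ep n v pr

theorem dressSum_zero (n : ℤ) : dressSum em x ep n 0 = 0 := by
  simp [dressSum, dressTerm]

theorem dressSum_add (hF : IsTruncFiltration F) (hx : ∀ n, x n ∈ degSub F n)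
    (hp : ∀ r : ℕ, ep r ∈ degSub F r) (n : ℤ) (v w : V) :
    dressSum em x ep n (v + w) = dressSum em x ep n v + dressSum em x ep n w := by
  rw [dressSum, dressSum, dressSum, ← finsum_add_distrib (dressTerm_support_finite hF hx hp n v)
    (dressTerm_support_finite hF hx hp n w)]
  exact finsum_congr fun pr => by simp [dressTerm]

theorem dressSum_smul (n : ℤ) (c : ℂ) (v : V) :
    dressSum em x ep n (c • v) = c • dressSum em x ep n v := by
  rw [dressSum, dressSum, smul_finsum]
  exact finsum_congr fun pr => by simp [dressTerm]

theorem dressSum_mem {S : Submodule ℂ V} (hem : ∀ p, em p ∈ stabSub S)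
    (hx : ∀ n, x n ∈ stabSub S) (hep : ∀ r, ep r ∈ stabSub S) (n : ℤ) {v : V} (hv : v ∈ S) :
    dressSum em x ep n v ∈ S :=
  finsum_induction (· ∈ S) (zero_mem S) (fun _ _ => add_mem)
    fun _ => hem _ _ (hx _ _ (hep _ _ hv))

theorem map_dressSum_sub (hF : IsTruncFiltration F) (hx : ∀ n, x n ∈ degSub F n)
    (hp : ∀ r : ℕ, ep r ∈ degSub F r) (A : Module.End ℂ V) (n : ℤ) (v : V) :
    A (dressSum em x ep n v) - dressSum em x ep n (A v)
      = ∑ᶠ pr : ℕ × ℕ, (A (dressTerm em x ep n v pr) - dressTerm em x ep n (A v) pr) := by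
  have hfin := dressTerm_support_finite (em := em) hF hx hp n v
  rw [dressSum, dressSum, ← LinearMap.toAddMonoidHom_coe, AddMonoidHom.map_finsum _ hfin,
    finsum_sub_distrib ?_ (dressTerm_support_finite hF hx hp n _)]
  refine hfin.subset fun pr hpr h0 => hpr ?_
  simp [h0]

/-- The dressed coefficients commute with an operator `A` of positive degree `m` such that the
contributions of `e⁻(z)` and `x(z)` to the commutator cancel. -/
theorem map_dressSum_of_pos (hF : IsTruncFiltration F) (hx : ∀ n, x n ∈ degSub F n)
    (hp : ∀ r : ℕ, ep r ∈ degSub F r) {A : Module.End ℂ V} {c : ℂ} {m : ℕ}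
    (hAe : ∀ p, A * em p - em p * A = if m ≤ p then (-c) • em (p - m) else 0)
    (hAx : ∀ n, A * x n - x n * A = c • x (m + n))
    (hAp : ∀ r, A * ep r - ep r * A = 0) (n : ℤ) (v : V) :
    A (dressSum em x ep n v) = dressSum em x ep n (A v) := by
  rw [← sub_eq_zero, map_dressSum_sub hF hx hp]
  -- The commutators with `x` and with `e⁻` yield the same family of terms, in degree `m + n`, with
  -- opposite signs and displaced by `m` in `p`. They cancel only after summation.
  have hterm : ∀ pr : ℕ × ℕ, A (dressTerm em x ep n v pr) - dressTerm em x ep n (A v) pr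
      = c • dressTerm em x ep (m + n) v pr
        - if m ≤ pr.1 then c • dressTerm em x ep (m + n) v (pr.1 - m, pr.2) else 0 := by
    rintro ⟨p, r⟩
    have h1 := congrArg (fun f => f (x (n + p - r) (ep r v))) (hAe p)
    have h2 := congrArg (fun f => em p (f (ep r v))) (hAx (n + p - r))
    have h3 := congrArg (fun f => em p (x (n + p - r) (f v))) (hAp r)
    simp only [LinearMap.sub_apply, Module.End.mul_apply, LinearMap.smul_apply, map_sub, map_smul,
      LinearMap.zero_apply, map_zero] at h1 h2 h3
    have key : A (em p (x (n + p - r) (ep r v))) - em p (x (n + p - r) (ep r (A v)))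
        = c • em p (x (m + (n + p - r)) (ep r v))
          + (if m ≤ p then (-c) • em (p - m) else 0 : Module.End ℂ V)
            (x (n + p - r) (ep r v)) := by
      rw [← h1, ← h2, eq_of_sub_eq_zero h3]; abel
    simp only [dressTerm]
    rw [key]
    refine (congrArg₂ (· + ·) ?_ ?_).trans (sub_eq_add_neg _ _).symm
    · ring_nf
    · split_ifs with hmp
      · rw [LinearMap.smul_apply, neg_smul]
        congr 4
        push_cast [Nat.cast_sub hmp]
        ring_nf
      · simp
  rw [finsum_congr hterm, finsum_sub_distrib, sub_eq_zero]
  · rw [finsum_shift (fun pr : ℕ × ℕ => (pr.1 + m, pr.2)) (f := fun pr : ℕ × ℕ => if m ≤ pr.1 then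
      c • dressTerm em x ep (m + n) v (pr.1 - m, pr.2) else 0)]
    · simp
    · rintro ⟨p, r⟩ ⟨p', r'⟩ h
      simpa using h
    · rintro ⟨p, r⟩ h
      refine if_neg fun hmp => h ⟨(p - m, r), ?_⟩
      simp only [Prod.mk.injEq, and_true]
      omega
  · exact (dressTerm_support_finite (em := em) hF hx hp (m + n) v).subset
      (Function.support_const_smul_subset _ _)
  · refine ((dressTerm_support_finite (em := em) hF hx hp (m + n) v).image
      fun pr : ℕ × ℕ => (pr.1 + m, pr.2)).subset ?_
    rintro ⟨p, r⟩ h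
    rw [Function.mem_support] at h
    split_ifs at h with hmp
    · refine ⟨(p - m, r), fun h0 => h (by rw [h0, smul_zero]), ?_⟩
      simp only [Prod.mk.injEq, and_true]
      omega
    · exact absurd rfl h

/-- The dressed coefficients commute with an operator `A` of negative degree `-m` such that the
contributions of `x(z)` and `e⁺(z)` to the commutator cancel. -/
theorem map_dressSum_of_neg (hF : IsTruncFiltration F) (hx : ∀ n, x n ∈ degSub F n)
    (hp : ∀ r : ℕ, ep r ∈ degSub F r) {A : Module.End ℂ V} {c : ℂ} {m : ℕ}
    (hAe : ∀ p, A * em p - em p * A = 0)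
    (hAx : ∀ n, A * x n - x n * A = c • x (-m + n))
    (hAp : ∀ r, A * ep r - ep r * A = if m ≤ r then (-c) • ep (r - m) else 0) (n : ℤ) (v : V) :
    A (dressSum em x ep n v) = dressSum em x ep n (A v) := by
  rw [← sub_eq_zero, map_dressSum_sub hF hx hp]
  -- The displacement by `m` is now in `r`, and comes from `e⁺`.
  have hterm : ∀ pr : ℕ × ℕ, A (dressTerm em x ep n v pr) - dressTerm em x ep n (A v) pr
      = c • dressTerm em x ep (-m + n) v pr
        - if m ≤ pr.2 then c • dressTerm em x ep (-m + n) v (pr.1, pr.2 - m) else 0 := by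
    rintro ⟨p, r⟩
    have h1 := congrArg (fun f => f (x (n + p - r) (ep r v))) (hAe p)
    have h2 := congrArg (fun f => em p (f (ep r v))) (hAx (n + p - r))
    have h3 := congrArg (fun f => em p (x (n + p - r) (f v))) (hAp r)
    simp only [LinearMap.sub_apply, Module.End.mul_apply, LinearMap.smul_apply, map_sub, map_smul,
      LinearMap.zero_apply] at h1 h2 h3
    have key : A (em p (x (n + p - r) (ep r v))) - em p (x (n + p - r) (ep r (A v)))
        = c • em p (x (-m + (n + p - r)) (ep r v))
          + em p (x (n + p - r)
            ((if m ≤ r then (-c) • ep (r - m) else 0 : Module.End ℂ V) v)) := by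
      rw [← h3, ← h2, eq_of_sub_eq_zero h1]; abel
    simp only [dressTerm]
    rw [key]
    refine (congrArg₂ (· + ·) ?_ ?_).trans (sub_eq_add_neg _ _).symm
    · ring_nf
    · split_ifs with hmr
      · rw [LinearMap.smul_apply, neg_smul, map_neg, map_neg, map_smul, map_smul]
        congr 4
        push_cast [Nat.cast_sub hmr]
        ring_nf
      · simp
  rw [finsum_congr hterm, finsum_sub_distrib, sub_eq_zero]
  · rw [finsum_shift (fun pr : ℕ × ℕ => (pr.1, pr.2 + m)) (f := fun pr : ℕ × ℕ => if m ≤ pr.2 then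
      c • dressTerm em x ep (-m + n) v (pr.1, pr.2 - m) else 0)]
    · simp
    · rintro ⟨p, r⟩ ⟨p', r'⟩ h
      simpa using h
    · rintro ⟨p, r⟩ h
      refine if_neg fun hmp => h ⟨(p, r - m), ?_⟩
      simp only [Prod.mk.injEq, true_and]
      omega
  · exact (dressTerm_support_finite (em := em) hF hx hp (-m + n) v).subset
      (Function.support_const_smul_subset _ _)
  · refine ((dressTerm_support_finite (em := em) hF hx hp (-m + n) v).image
      fun pr : ℕ × ℕ => (pr.1, pr.2 + m)).subset ?_
    rintro ⟨p, r⟩ h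
    rw [Function.mem_support] at h
    split_ifs at h with hmp
    · refine ⟨(p, r - m), fun h0 => h (by rw [h0, smul_zero]), ?_⟩
      simp only [Prod.mk.injEq, true_and]
      omega
    · exact absurd rfl h

/-- A subspace stable under the dressed coefficients and under the dressing factors is stable
under the coefficients of `x(z)`. -/
theorem mem_stabSub_of_dressSum_mem (hF : IsTruncFiltration F) (hx : ∀ n, x n ∈ degSub F n)
    (hp : ∀ r : ℕ, ep r ∈ degSub F r) (hem0 : em 0 = 1) (hep0 : ep 0 = 1) {S : Submodule ℂ V}
    (hem : ∀ p, em p ∈ stabSub S) (hep : ∀ r, ep r ∈ stabSub S)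
    (hZ : ∀ n, ∀ v ∈ S, dressSum em x ep n v ∈ S) (n : ℤ) : x n ∈ stabSub S := by
  -- The term `(0, 0)` of the dressed coefficient is `x n v`, so the others must be controlled.
  -- Those with `r > 0` apply `x` to a vector of smaller index (outer induction on `M`); those with
  -- `r = 0 < p` involve `x (n + p)`, of higher degree (inner induction on `M - n`).
  have main : ∀ M : ℕ, ∀ v ∈ S, v ∈ F M → ∀ n, x n v ∈ S := by
    intro M
    induction M using Nat.strong_induction_on with
    | _ M ihM =>
    intro v hv hvM
    have inner : ∀ t : ℕ, ∀ n : ℤ, M - n ≤ t → x n v ∈ S := by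
      intro t
      induction t with
      | zero =>
        intro n hn
        rw [hF.eq_zero (by simpa using hn) (hx n _ _ hvM)]
        exact zero_mem _
      | succ t iht =>
        intro n hn
        have hrest : ∀ pr : ℕ × ℕ, pr ≠ (0, 0) → dressTerm em x ep n v pr ∈ S := by
          rintro ⟨p, r⟩ hpr
          refine hem _ _ ?_
          rcases Nat.eq_zero_or_pos r with rfl | hr
          · have hp0 : p ≠ 0 := fun h => hpr (by rw [h])
            simp only [hep0, Module.End.one_apply]
            exact iht _ (by push_cast; omega)
          · by_cases hrM : r ≤ M
            · refine ihM (M - r) (by omega) _ (hep _ _ hv) ?_ _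
              rw [Nat.cast_sub hrM]
              exact hp _ _ _ hvM
            · rw [hF.eq_zero (by omega) (hp r _ _ hvM), map_zero]
              exact zero_mem _
        have hfin := dressTerm_support_finite (em := em) hF hx hp n v
        classical
        have hsum : dressSum em x ep n v = ∑ pr ∈ insert (0, 0) hfin.toFinset,
            dressTerm em x ep n v pr :=
          finsum_eq_sum_of_support_subset _ (by simp)
        have h00 : dressTerm em x ep n v (0, 0) = x n v := by
          simp [dressTerm, hem0, hep0]
        rw [← Finset.add_sum_erase _ _ (Finset.mem_insert_self _ _), h00] at hsum
        rw [← sub_eq_iff_eq_add] at hsum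
        rw [← hsum]
        exact sub_mem (hZ n v hv) (sum_mem fun pr hpr => hrest pr (Finset.ne_of_mem_erase hpr))
    exact fun n => inner (M - n).toNat n (Int.self_le_toNat _)
  intro v hv
  obtain ⟨M, hM⟩ := hF.exhaust v
  exact main M v hv hM n

end Dressing

/-! ### Representations of a nondegenerate Heisenberg algebra -/

section Heisenberg

open Polynomial

variable {V : Type*} [AddCommGroup V] [Module ℂ V] {ι : Type*}

/-- The common kernel of the annihilation operators. -/
def vacuumOf (a : ι → ℤ → Module.End ℂ V) : Submodule ℂ V :=
  ⨅ (i : ι) (n : ℕ) (_ : 0 < n), LinearMap.ker (a i n)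

theorem mem_vacuumOf {a : ι → ℤ → Module.End ℂ V} {v : V} :
    v ∈ vacuumOf a ↔ ∀ i, ∀ n : ℕ, 0 < n → a i n v = 0 := by
  simp [vacuumOf]

/-- The sum of the images of the creation operators. -/
def creationRange (a : ι → ℤ → Module.End ℂ V) : Submodule ℂ V :=
  ⨆ (i : ι) (n : ℕ) (_ : 0 < n), LinearMap.range (a i (-n))

theorem apply_mem_creationRange (a : ι → ℤ → Module.End ℂ V) (i : ι) {n : ℕ} (hn : 0 < n) (v : V) :
    a i (-n) v ∈ creationRange a :=
  Submodule.mem_iSup_of_mem i <| Submodule.mem_iSup_of_mem n <| Submodule.mem_iSup_of_mem hn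
    ⟨v, rfl⟩

variable [Fintype ι] [DecidableEq ι]

/-- Operators `a i n` of degree `n` that satisfy the relations of a Heisenberg algebra with
nondegenerate forms `β n`, `n > 0`. -/
structure IsHeisenberg (F : ℤ → Submodule ℂ V) (a : ι → ℤ → Module.End ℂ V)
    (β : ℕ → Matrix ι ι ℂ) : Prop where
  filt : IsTruncFiltration F
  deg : ∀ i n, a i n ∈ degSub F n
  comm_pos : ∀ i j (m n : ℕ), 0 < m → 0 < n → Commute (a i m) (a j n)
  comm_neg : ∀ i j (m n : ℕ), 0 < m → 0 < n → Commute (a i (-m)) (a j (-n))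
  comm : ∀ i j (m n : ℕ), 0 < m → 0 < n →
    a i m * a j (-n) - a j (-n) * a i m = if m = n then β m i j • 1 else 0
  nondeg : ∀ m : ℕ, 0 < m → IsUnit (β m).det

/-- The annihilation operators dual to the creation operators. -/
def dualOp (a : ι → ℤ → Module.End ℂ V) (β : ℕ → Matrix ι ι ℂ) (j : ι) (n : ℕ) :
    Module.End ℂ V :=
  ∑ i, (β n)⁻¹ j i • a i n

/-- The number operator of the modes `1, …, M`. -/
def numOp (a : ι → ℤ → Module.End ℂ V) (β : ℕ → Matrix ι ι ℂ) (M : ℕ) : Module.End ℂ V :=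
  ∑ n ∈ Finset.range M, ∑ j, a j (-(n + 1 : ℕ)) * dualOp a β j (n + 1)

/-- `X (X - 1) ⋯ (X - (R - 1))`. -/
def fallPoly (R : ℕ) : ℂ[X] := ∏ r ∈ Finset.range R, (X - C (r : ℂ))

/-- `(X - 1) ⋯ (X - R)`. -/
def shiftedFallPoly (R : ℕ) : ℂ[X] := ∏ r ∈ Finset.range R, (X - C ((r : ℂ) + 1))

theorem fallPoly_succ' (R : ℕ) : fallPoly (R + 1) = shiftedFallPoly R * X := by
  rw [fallPoly, Finset.prod_range_succ']
  simp [shiftedFallPoly]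

theorem shiftedFallPoly_eval_zero_ne (R : ℕ) : (shiftedFallPoly R).eval 0 ≠ 0 := by
  rw [shiftedFallPoly, eval_prod, Finset.prod_ne_zero_iff]
  intro r _
  rw [eval_sub, eval_X, eval_C, zero_sub]
  exact neg_ne_zero.mpr (Nat.cast_add_one_ne_zero r)

theorem fallPoly_eval_neg_one_ne (R : ℕ) : (fallPoly R).eval (-1) ≠ 0 := by
  rw [fallPoly, eval_prod, Finset.prod_ne_zero_iff]
  intro r _ h
  rw [eval_sub, eval_X, eval_C, sub_eq_zero, eq_comm] at h
  have := Nat.cast_add_one_ne_zero (R := ℂ) r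
  rw [h] at this
  simp at this

theorem shiftedFallPoly_dvd {R R' : ℕ} (h : R ≤ R') : shiftedFallPoly R ∣ shiftedFallPoly R' :=
  Finset.prod_dvd_prod_of_subset _ _ _ (Finset.range_subset_range.mpr h)

/-- The hypothesis says that `a` raises eigenvalues of `D` by one, so moving a polynomial in `D`
past `a` replaces `X` by `X + 1`. -/
theorem aeval_shiftedFallPoly_mul {D a : Module.End ℂ V} (h : D * a = a * D + a) (R : ℕ) :
    aeval D (shiftedFallPoly R) * a = a * aeval D (fallPoly R) := by
  induction R with
  | zero => simp [shiftedFallPoly, fallPoly]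
  | succ R ih =>
    have e : aeval D (X - C ((R : ℂ) + 1)) * a = a * aeval D (X - C (R : ℂ)) := by
      simp only [map_sub, aeval_X, aeval_C, map_add, map_one, sub_mul, mul_sub, h, add_mul, one_mul,
        Algebra.commutes]
      abel
    rw [shiftedFallPoly, fallPoly, Finset.prod_range_succ, Finset.prod_range_succ, map_mul, map_mul,
      mul_assoc, e, ← mul_assoc, ← mul_assoc]
    exact congrArg (· * _) ih

theorem aeval_apply_of_apply_eq_smul {D : Module.End ℂ V} {c : ℂ} {v : V} (h : D v = c • v)
    (f : ℂ[X]) : aeval D f v = f.eval c • v := by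
  induction f using Polynomial.induction_on' with
  | add p q hp hq => simp [hp, hq, add_smul]
  | monomial n s =>
    have : (D ^ n) v = c ^ n • v := by
      induction n with
      | zero => simp
      | succ n ih => rw [pow_succ', Module.End.mul_apply, ih, map_smul, h, smul_smul, pow_succ]
    simp [aeval_monomial, this, smul_smul, mul_comm]

namespace IsHeisenberg

variable {F : ℤ → Submodule ℂ V} {a : ι → ℤ → Module.End ℂ V} {β : ℕ → Matrix ι ι ℂ}

theorem dualOp_comm (H : IsHeisenberg F a β) (j l : ι) {m n : ℕ} (hm : 0 < m) (hn : 0 < n) :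
    dualOp a β j m * a l (-n) - a l (-n) * dualOp a β j m = if m = n ∧ j = l then 1 else 0 := by
  have e : dualOp a β j m * a l (-n) - a l (-n) * dualOp a β j m
      = ∑ i, (β m)⁻¹ j i • (a i m * a l (-n) - a l (-n) * a i m) := by
    simp only [dualOp, Finset.sum_mul, Finset.mul_sum, smul_mul_assoc, mul_smul_comm,
      ← Finset.sum_sub_distrib, ← smul_sub]
  rw [e]
  simp only [H.comm _ _ _ _ hm hn]
  by_cases hmn : m = n
  · simp only [hmn, if_true, true_and, smul_smul, ← Finset.sum_smul]
    have := congrFun (congrFun (Matrix.nonsing_inv_mul (β n) (H.nondeg n hn)) j) l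
    rw [Matrix.mul_apply] at this
    rw [this, Matrix.one_apply]
    split_ifs <;> simp
  · simp [hmn]

theorem dualOp_commute (H : IsHeisenberg F a β) (j l : ι) {m n : ℕ} (hm : 0 < m) (hn : 0 < n) :
    Commute (dualOp a β j m) (dualOp a β l n) :=
  Commute.sum_left _ _ _ fun i _ => Commute.sum_right _ _ _ fun i' _ =>
    ((H.comm_pos i i' m n hm hn).smul_left _).smul_right _

theorem dualOp_mem_degSub (H : IsHeisenberg F a β) (j : ι) (n : ℕ) :
    dualOp a β j n ∈ degSub F n :=
  sum_mem fun i _ => Submodule.smul_mem _ _ (H.deg i n)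

theorem apply_eq_zero_of_dualOp (H : IsHeisenberg F a β) {n : ℕ} (hn : 0 < n) {v : V}
    (hv : ∀ j, dualOp a β j n v = 0) (i : ι) : a i n v = 0 := by
  have e : a i n = ∑ j, β n i j • dualOp a β j n := by
    simp only [dualOp, Finset.smul_sum, smul_smul]
    rw [Finset.sum_comm]
    simp only [← Finset.sum_smul, ← Matrix.mul_apply, Matrix.mul_nonsing_inv _ (H.nondeg n hn)]
    simp [Matrix.one_apply]
  simp [e, hv]

/-- Only the summand of mode `n` fails to commute with `a i (-n)`; the bound `n ≤ M` ensures that it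
is present. -/
theorem numOp_mul_creation (H : IsHeisenberg F a β) {M n : ℕ} (hn : 0 < n) (hnM : n ≤ M) (i : ι) :
    numOp a β M * a i (-n) = a i (-n) * numOp a β M + a i (-n) := by
  rw [← sub_eq_iff_eq_add', numOp, Finset.sum_mul, Finset.mul_sum, ← Finset.sum_sub_distrib]
  have e : ∀ m ∈ Finset.range M, (∑ j, a j (-(m + 1 : ℕ)) * dualOp a β j (m + 1)) * a i (-n)
      - a i (-n) * (∑ j, a j (-(m + 1 : ℕ)) * dualOp a β j (m + 1))
      = if m = n - 1 then a i (-n) else 0 := by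
    intro m _
    rw [Finset.sum_mul, Finset.mul_sum, ← Finset.sum_sub_distrib]
    have e1 : ∀ j, a j (-(m + 1 : ℕ)) * dualOp a β j (m + 1) * a i (-n)
        - a i (-n) * (a j (-(m + 1 : ℕ)) * dualOp a β j (m + 1))
        = if m + 1 = n ∧ j = i then a j (-(m + 1 : ℕ)) else 0 := by
      intro j
      rw [← mul_assoc, (H.comm_neg i j n (m + 1) hn m.succ_pos).eq, mul_assoc, mul_assoc,
        ← mul_sub, H.dualOp_comm j i m.succ_pos hn]
      split_ifs <;> simp
    simp only [e1]
    by_cases hmn : m + 1 = n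
    · subst hmn
      simp
    · rw [if_neg (by omega)]
      simp [hmn]
  rw [Finset.sum_congr rfl e, Finset.sum_ite_eq', if_pos (Finset.mem_range.mpr (by omega))]

theorem dualOp_mul_numOp (H : IsHeisenberg F a β) {M n : ℕ} (hn : 0 < n) (hnM : n ≤ M) (i : ι) :
    dualOp a β i n * numOp a β M = numOp a β M * dualOp a β i n + dualOp a β i n := by
  rw [← sub_eq_iff_eq_add', numOp, Finset.sum_mul, Finset.mul_sum, ← Finset.sum_sub_distrib]
  have e : ∀ m ∈ Finset.range M,
      dualOp a β i n * (∑ j, a j (-(m + 1 : ℕ)) * dualOp a β j (m + 1))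
      - (∑ j, a j (-(m + 1 : ℕ)) * dualOp a β j (m + 1)) * dualOp a β i n
      = if m = n - 1 then dualOp a β i n else 0 := by
    intro m _
    rw [Finset.sum_mul, Finset.mul_sum, ← Finset.sum_sub_distrib]
    have e1 : ∀ j, dualOp a β i n * (a j (-(m + 1 : ℕ)) * dualOp a β j (m + 1))
        - a j (-(m + 1 : ℕ)) * dualOp a β j (m + 1) * dualOp a β i n
        = if n = m + 1 ∧ i = j then dualOp a β j (m + 1) else 0 := by
      intro j
      rw [mul_assoc, (H.dualOp_commute j i m.succ_pos hn).eq, ← mul_assoc, ← mul_assoc,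
        ← sub_mul, H.dualOp_comm i j hn m.succ_pos]
      split_ifs <;> simp
    simp only [e1]
    by_cases hmn : n = m + 1
    · subst hmn
      simp
    · rw [if_neg (by omega)]
      simp [hmn]
  rw [Finset.sum_congr rfl e, Finset.sum_ite_eq', if_pos (Finset.mem_range.mpr (by omega))]

theorem numOp_apply (M : ℕ) (v : V) : numOp a β M v
    = ∑ n ∈ Finset.range M, ∑ j, a j (-(n + 1 : ℕ)) (dualOp a β j (n + 1) v) := by
  simp [numOp, LinearMap.sum_apply]

theorem numOp_mem_degSub (H : IsHeisenberg F a β) (M : ℕ) : numOp a β M ∈ degSub F 0 := by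
  refine sum_mem fun n _ => sum_mem fun j _ => ?_
  have := mul_mem_degSub (H.deg j (-(n + 1 : ℕ))) (H.dualOp_mem_degSub j (n + 1))
  rwa [neg_add_cancel] at this

theorem aeval_numOp_mem (H : IsHeisenberg F a β) (M : ℕ) (f : ℂ[X]) {R : ℤ} {v : V}
    (hv : v ∈ F R) : aeval (numOp a β M) f v ∈ F R := by
  induction f using Polynomial.induction_on' with
  | add p q hp hq => rw [map_add]; exact add_mem hp hq
  | monomial n s =>
    rw [aeval_monomial, Module.End.mul_apply, Module.algebraMap_end_apply]
    refine Submodule.smul_mem _ _ ?_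
    induction n with
    | zero => simpa using hv
    | succ n ih =>
      rw [pow_succ', Module.End.mul_apply]
      simpa using H.numOp_mem_degSub M R _ ih

/-- On index `R` the number operator has eigenvalues among `0, …, R - 1`, whatever the truncation
`M`. Each annihilator lowers the index by at least one, and moving the polynomial past the creator
on its left reduces `R + 1` to `R`. -/
theorem aeval_fallPoly_numOp_eq_zero (H : IsHeisenberg F a β) (M R : ℕ) {v : V} (hv : v ∈ F R) :
    aeval (numOp a β M) (fallPoly R) v = 0 := by
  induction R generalizing v with
  | zero => rw [H.filt.eq_zero le_rfl hv, map_zero]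
  | succ R ih =>
    rw [fallPoly_succ', map_mul, Module.End.mul_apply, aeval_X, numOp_apply]
    simp only [map_sum]
    refine Finset.sum_eq_zero fun n hn => Finset.sum_eq_zero fun j _ => ?_
    have hcomm := H.numOp_mul_creation n.succ_pos (Finset.mem_range.mp hn) j
    have := LinearMap.congr_fun (aeval_shiftedFallPoly_mul hcomm R) (dualOp a β j (n + 1) v)
    rw [Module.End.mul_apply, Module.End.mul_apply, ih, map_zero] at this
    · exact this
    · exact H.filt.mono (by push_cast; omega) (H.dualOp_mem_degSub j (n + 1) _ _ hv)

theorem numOp_apply_eq_zero_of_mem_vacuumOf {M : ℕ} {v : V} (hv : v ∈ vacuumOf a) :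
    numOp a β M v = 0 := by
  rw [mem_vacuumOf] at hv
  rw [numOp_apply]
  refine Finset.sum_eq_zero fun n _ => Finset.sum_eq_zero fun j _ => ?_
  have : dualOp a β j (n + 1) v = 0 := by
    rw [dualOp, LinearMap.sum_apply]
    exact Finset.sum_eq_zero fun i _ => by
      rw [LinearMap.smul_apply, hv i _ n.succ_pos, smul_zero]
  rw [this, map_zero]

/-- A vector of filtration index `M` that is killed by the number operator of the first `M` modes
is a vacuum vector. -/
theorem mem_vacuumOf_of_numOp_apply_eq_zero (H : IsHeisenberg F a β) {M : ℕ} {v : V}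
    (hvM : v ∈ F M) (hv : numOp a β M v = 0) : v ∈ vacuumOf a := by
  rw [mem_vacuumOf]
  intro i n hn
  by_cases hnM : n ≤ M
  · refine H.apply_eq_zero_of_dualOp hn (fun j => ?_) i
    have h1 := LinearMap.congr_fun (H.dualOp_mul_numOp hn hnM j) v
    rw [Module.End.mul_apply, hv, map_zero, LinearMap.add_apply, Module.End.mul_apply] at h1
    -- Annihilators lower the number operator by one, so a nonzero image would be an eigenvector
    -- with eigenvalue `-1`, which is not a root of `fallPoly M`.
    have h2 : numOp a β M (dualOp a β j n v) = (-1 : ℂ) • dualOp a β j n v := by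
      rw [neg_one_smul]; exact eq_neg_of_add_eq_zero_left h1.symm
    have h3 := H.aeval_fallPoly_numOp_eq_zero M M
      (H.filt.mono (by omega) (H.dualOp_mem_degSub j n _ _ hvM))
    rw [aeval_apply_of_apply_eq_smul h2] at h3
    exact (smul_eq_zero.mp h3).resolve_left (fallPoly_eval_neg_one_ne M)
  · exact H.filt.eq_zero (by omega) (H.deg i n _ _ hvM)

/-- A subspace that contains the vacuum vectors and is stable under the Heisenberg algebra is the
whole space. -/
theorem eq_top_of_vacuumOf_le (H : IsHeisenberg F a β) {S : Submodule ℂ V}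
    (hS : ∀ i, ∀ n : ℕ, 0 < n → a i (-n) ∈ stabSub S) (hΩ : vacuumOf a ≤ S) : S = ⊤ := by
  have main : ∀ R : ℕ, F R ≤ S := by
    intro R
    induction R with
    | zero => rw [Nat.cast_zero, H.filt.eq_bot 0 le_rfl]; exact bot_le
    | succ R ih =>
      intro v hv
      -- The number operator first annihilates, landing in `F R ≤ S`, and then creates, which
      -- preserves `S`.
      have hD : ∀ w ∈ F (R + 1 : ℕ), numOp a β (R + 1) w ∈ S := by
        intro w hw
        rw [numOp_apply]
        refine sum_mem fun n _ => sum_mem fun j _ => hS j _ n.succ_pos _ (ih ?_)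
        exact H.filt.mono (by push_cast; omega) (H.dualOp_mem_degSub j (n + 1) _ _ hw)
      set D := numOp a β (R + 1) with hDdef
      -- Up to a scalar, `shiftedFallPoly (R + 1)` evaluated at `D` projects onto the kernel of `D`,
      -- hence onto vacuum vectors. Its nonzero constant term then isolates `v` modulo the image of
      -- `D`.
      have hw0 : D (aeval D (shiftedFallPoly (R + 1)) v) = 0 := by
        have h1 := H.aeval_fallPoly_numOp_eq_zero (R + 1) (R + 1 + 1)
          (H.filt.mono (by push_cast; omega) hv)
        rwa [fallPoly_succ', mul_comm, map_mul, Module.End.mul_apply, aeval_X] at h1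
      have hw : aeval D (shiftedFallPoly (R + 1)) v ∈ S :=
        hΩ (H.mem_vacuumOf_of_numOp_apply_eq_zero (H.aeval_numOp_mem _ _ hv) hw0)
      rw [← X_mul_divX_add (shiftedFallPoly (R + 1)), map_add, map_mul, aeval_X, aeval_C,
        LinearMap.add_apply, Module.End.mul_apply, Module.algebraMap_end_apply,
        coeff_zero_eq_eval_zero] at hw
      have := (Submodule.add_mem_iff_right S (hD _ (H.aeval_numOp_mem _ _ hv))).mp hw
      exact (Submodule.smul_mem_iff S (shiftedFallPoly_eval_zero_ne _)).mp this
  refine eq_top_iff.mpr fun v _ => ?_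
  obtain ⟨M, hM⟩ := H.filt.exhaust v
  exact main M hM

/-- A vacuum vector in the sum of the images of the creation operators is zero. -/
theorem eq_zero_of_mem_vacuumOf_of_mem_creationRange (H : IsHeisenberg F a β) {v : V}
    (hΩ : v ∈ vacuumOf a) (hv : v ∈ creationRange a) : v = 0 := by
  -- On the creation range the number operator has only positive eigenvalues, provided that its
  -- truncation `M` includes every mode used to write `u`; hence the threshold `M₀`. On the vacuum
  -- the eigenvalue is `0`.
  have key : ∀ u ∈ creationRange a, ∃ M₀ R : ℕ, ∀ M ≥ M₀,
      aeval (numOp a β M) (shiftedFallPoly R) u = 0 := by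
    intro u hu
    have hle : creationRange a ≤
        Submodule.span ℂ {u | ∃ (i : ι) (n : ℕ) (w : V), 0 < n ∧ u = a i (-n) w} := by
      refine iSup_le fun i => iSup_le fun n => iSup_le fun hn => ?_
      rintro _ ⟨w, rfl⟩
      exact Submodule.subset_span ⟨i, n, w, hn, rfl⟩
    refine Submodule.span_induction ?_ ?_ ?_ ?_ (hle hu)
    · rintro _ ⟨i, n, w, hn, rfl⟩
      obtain ⟨R, hR⟩ := H.filt.exhaust w
      refine ⟨n, R, fun M hM => ?_⟩
      have := LinearMap.congr_fun (aeval_shiftedFallPoly_mul (H.numOp_mul_creation hn hM i) R) w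
      rwa [Module.End.mul_apply, Module.End.mul_apply, H.aeval_fallPoly_numOp_eq_zero M R hR,
        map_zero] at this
    · exact ⟨0, 0, fun _ _ => map_zero _⟩
    · rintro x y - - ⟨M₁, R₁, h₁⟩ ⟨M₂, R₂, h₂⟩
      refine ⟨max M₁ M₂, max R₁ R₂, fun M hM => ?_⟩
      obtain ⟨g₁, hg₁⟩ := shiftedFallPoly_dvd (le_max_left R₁ R₂)
      obtain ⟨g₂, hg₂⟩ := shiftedFallPoly_dvd (le_max_right R₁ R₂)
      rw [map_add]
      nth_rewrite 1 [hg₁]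
      rw [hg₂, mul_comm, map_mul, Module.End.mul_apply, h₁ M (le_of_max_le_left hM), map_zero,
        mul_comm, map_mul, Module.End.mul_apply, h₂ M (le_of_max_le_right hM), map_zero, add_zero]
    · rintro c x - ⟨M₁, R₁, h₁⟩
      exact ⟨M₁, R₁, fun M hM => by rw [map_smul, h₁ M hM, smul_zero]⟩
  obtain ⟨M, R, h⟩ := key v hv
  have h1 := h M le_rfl
  have h2 : numOp a β M v = (0 : ℂ) • v := by
    rw [zero_smul, numOp_apply_eq_zero_of_mem_vacuumOf hΩ]
  rw [aeval_apply_of_apply_eq_smul h2] at h1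
  exact (smul_eq_zero.mp h1).resolve_left (shiftedFallPoly_eval_zero_ne R)

end IsHeisenberg

end Heisenberg

/-! ### Nondegeneracy of the `q`-deformed symmetrized Cartan matrices -/

section Nondegenerate

/-- An injective "exponential function" on the rational numbers. -/
structure IsGenericExp (P : ℚ → ℂ) : Prop where
  zero : P 0 = 1
  add : ∀ x y, P (x + y) = P x * P y
  ne_one : ∀ x, x ≠ 0 → P x ≠ 1

/-- `P x - P (-x)`. -/
def oddPart (P : ℚ → ℂ) (x : ℚ) : ℂ := P x - P (-x)

theorem oddPart_neg (P : ℚ → ℂ) (x : ℚ) : oddPart P (-x) = -oddPart P x := by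
  simp [oddPart]

@[simp] theorem oddPart_zero (P : ℚ → ℂ) : oddPart P 0 = 0 := by
  simp [oddPart]

namespace IsGenericExp

variable {P : ℚ → ℂ}

theorem mul_neg (hP : IsGenericExp P) (x : ℚ) : P x * P (-x) = 1 := by
  rw [← hP.add, add_neg_cancel, hP.zero]

theorem pow_eq (hP : IsGenericExp P) (x : ℚ) (n : ℕ) : P x ^ n = P (n * x) := by
  induction n with
  | zero => simp [hP.zero]
  | succ n ih => rw [pow_succ, ih, ← hP.add]; congr 1; push_cast; ring

theorem pow_ne_one (hP : IsGenericExp P) {x : ℚ} (hx : x ≠ 0) (n : ℕ) (hn : 0 < n) :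
    P x ^ n ≠ 1 := by
  rw [hP.pow_eq]
  exact hP.ne_one _ (mul_ne_zero (by exact_mod_cast hn.ne') hx)

theorem oddPart_eq (hP : IsGenericExp P) (x y : ℚ) (n : ℕ) (h : x = n * y) :
    oddPart P x = P y ^ n - P (-y) ^ n := by
  rw [hP.pow_eq, hP.pow_eq, oddPart, h, neg_mul_eq_mul_neg]

end IsGenericExp

/-! ### Scalars that are not roots of unity, and the `q`-integer recursion. -/

section Scalars

variable {u v : ℂ}

theorem pow_sub_pow_ne_zero (huv : u * v = 1) (hu : ∀ n : ℕ, 0 < n → u ^ n ≠ 1) {n : ℕ}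
    (hn : 0 < n) : u ^ n - v ^ n ≠ 0 := by
  intro h
  refine hu (2 * n) (by omega) ?_
  have : u ^ n * v ^ n = 1 := by rw [← mul_pow, huv, one_pow]
  rw [mul_comm, pow_mul]
  linear_combination u ^ n * h + this

/-- Vanishing would give `u ^ (2n) = -1`, hence `u ^ (4n) = 1`. -/
theorem pow_add_pow_ne_zero (huv : u * v = 1) (hu : ∀ n : ℕ, 0 < n → u ^ n ≠ 1) {n : ℕ}
    (hn : 0 < n) : u ^ n + v ^ n ≠ 0 := by
  intro h
  refine hu (4 * n) (by omega) ?_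
  have : u ^ n * v ^ n = 1 := by rw [← mul_pow, huv, one_pow]
  rw [mul_comm, pow_mul]
  linear_combination u ^ n * (u ^ n * u ^ n - 1) * h - (u ^ n * u ^ n - 1) * this

/-- With `a = u ^ n`, vanishing means `a² - a + 1 = 0`, a factor of `a⁶ - 1`. -/
theorem pow_add_pow_sub_one_ne_zero (huv : u * v = 1) (hu : ∀ n : ℕ, 0 < n → u ^ n ≠ 1) {n : ℕ}
    (hn : 0 < n) : u ^ n + v ^ n - 1 ≠ 0 := by
  intro h
  refine hu (6 * n) (by omega) ?_
  have h1 : u ^ n * v ^ n = 1 := by rw [← mul_pow, huv, one_pow]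
  rw [mul_comm, pow_mul]
  generalize u ^ n = a at *
  have h2 : a ^ 2 - a + 1 = 0 := by linear_combination a * h - h1
  linear_combination (a ^ 4 + a ^ 3 - a - 1) * h2

/-- The recursion is that of `q`-integers: started at `0` it gives `y j = [j] y 1`, written here
without denominators. -/
theorem chain_eq (huv : u * v = 1) {y : ℕ → ℂ} (h0 : y 0 = 0) {L : ℕ}
    (hy : ∀ j, j + 2 ≤ L → (u + v) * y (j + 1) = y j + y (j + 2)) (j : ℕ) (hj : j ≤ L) :
    (u - v) * y j = (u ^ j - v ^ j) * y 1 := by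
  induction j using Nat.strong_induction_on with
  | _ j ih =>
    match j with
    | 0 => simp [h0]
    | 1 => simp
    | j + 2 =>
      have h1 := ih (j + 1) (by omega) (by omega)
      have h2 := ih j (by omega) (by omega)
      have h3 := hy j hj
      linear_combination (-(u - v)) * h3 + (u + v) * h1 - h2 + (u ^ j - v ^ j) * y 1 * huv

end Scalars

theorem sum_fin_ite_eq {l : ℕ} (K : ℂ) (n : ℕ) :
    ∑ j : Fin l, (if (j : ℕ) = n then K else 0) = if n < l then K else 0 := by
  rw [Fin.sum_univ_eq_sum_range (fun j => if j = n then K else 0) l, Finset.sum_ite_eq']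
  simp

/-- A row of a tridiagonal matrix, applied to a vector. -/
theorem sum_fin_tridiagonal {l : ℕ} {y : ℕ → ℂ} (h0 : y 0 = 0) (hl : y (l + 1) = 0) (i : Fin l)
    {g : Fin l → ℂ} {A B C : ℂ} (hA : g i = A) (hB : ∀ j : Fin l, (i : ℕ) + 1 = j → g j = B)
    (hC : ∀ j : Fin l, (j : ℕ) + 1 = i → g j = C)
    (hg : ∀ j : Fin l, j ≠ i → (i : ℕ) + 1 ≠ j → (j : ℕ) + 1 ≠ i → g j = 0) :
    ∑ j, g j * y (j + 1) = A * y (i + 1) + B * y (i + 2) + C * y i := by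
  -- For `i = 0` the truncated `i - 1` is `0` and selects a spurious term, harmless since its value
  -- contains `y 0 = 0`.
  have e : ∀ j : Fin l, g j * y (j + 1) = (if (j : ℕ) = i then A * y (i + 1) else 0)
      + (if (j : ℕ) = i + 1 then B * y (i + 2) else 0)
      + (if (j : ℕ) = i - 1 then C * y i else 0) := by
    intro j
    rcases lt_trichotomy (j : ℕ) i with hji | hji | hji
    · rw [if_neg (by omega), if_neg (by omega)]
      by_cases hj : (j : ℕ) + 1 = i
      · rw [if_pos (by omega), hC j hj, hj]; ring
      · rw [if_neg (by omega), hg j (by rintro rfl; omega) (by omega) hj]; ring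
    · have : j = i := Fin.ext hji
      subst this
      rw [if_pos rfl, if_neg (by omega), hA]
      by_cases hj : (j : ℕ) = 0
      · rw [hj, h0]; simp
      · rw [if_neg (by omega)]; ring
    · rw [if_neg (by omega), if_neg (c := (j : ℕ) = i - 1) (by omega)]
      by_cases hj : (i : ℕ) + 1 = j
      · rw [if_pos (by omega), hB j hj, ← hj]; ring
      · rw [if_neg (by omega), hg j (by rintro rfl; omega) hj (by omega)]; ring
  rw [Finset.sum_congr rfl fun j _ => e j, Finset.sum_add_distrib, Finset.sum_add_distrib,
    sum_fin_ite_eq, sum_fin_ite_eq, sum_fin_ite_eq, if_pos i.isLt,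
    if_pos (c := (i : ℕ) - 1 < l) (by omega)]
  congr 2
  split_ifs with h
  · rfl
  · rw [show (i : ℕ) + 2 = l + 1 by omega, hl, mul_zero]

/-- The vector `c`, shifted by one and extended by zero. -/
def extendVec {l : ℕ} (c : Fin l → ℂ) (j : ℕ) : ℂ :=
  if h : 0 < j ∧ j ≤ l then c ⟨j - 1, by omega⟩ else 0

@[simp] theorem extendVec_zero {l : ℕ} (c : Fin l → ℂ) : extendVec c 0 = 0 := by simp [extendVec]

theorem extendVec_end {l : ℕ} (c : Fin l → ℂ) : extendVec c (l + 1) = 0 := by simp [extendVec]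

theorem extendVec_succ {l : ℕ} (c : Fin l → ℂ) (j : Fin l) : extendVec c (j + 1) = c j := by
  have : (j : ℕ) + 1 ≤ l := j.isLt
  simp [extendVec, this]

/-! ### The classical types. -/

variable {P : ℚ → ℂ}

theorem eq_zero_of_chain {u v : ℂ} (huv : u * v = 1) (hu : ∀ n : ℕ, 0 < n → u ^ n ≠ 1)
    {y : ℕ → ℂ} {L : ℕ} (hy : ∀ j ≤ L, (u - v) * y j = (u ^ j - v ^ j) * y 1) (h1 : y 1 = 0)
    (j : ℕ) (hj : j ≤ L) : y j = 0 := by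
  have := hy j hj
  rw [h1, mul_zero] at this
  exact (mul_eq_zero.mp this).resolve_left (by simpa using pow_sub_pow_ne_zero huv hu one_pos)

theorem eq_zero_of_extendVec {l : ℕ} {c : Fin l → ℂ} (h : ∀ j < l, extendVec c (j + 1) = 0) :
    c = 0 := by
  funext j
  rw [← extendVec_succ c j]
  exact h j j.isLt

/-- Dividing each row by `u - v` gives the `q`-integer recursion, so the boundary value `y (l + 1) =
0` forces `[l + 1] y 1 = 0`. -/
theorem eq_zero_of_form_A (hP : IsGenericExp P) {l : ℕ} (f : Fin l → Fin l → ℚ)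
    (hf : ∀ i j, f i j = if (i : ℕ) = j then 2
      else if (i : ℕ) + 1 = j ∨ (j : ℕ) + 1 = i then -1 else 0)
    (c : Fin l → ℂ) (hc : ∀ i, ∑ j, oddPart P (f i j) * c j = 0) : c = 0 := by
  set y := extendVec c with hy
  set u := P 1 with hu
  set v := P (-1) with hv
  have huv : u * v = 1 := hP.mul_neg 1
  have hu1 : ∀ n : ℕ, 0 < n → u ^ n ≠ 1 := hP.pow_ne_one one_ne_zero
  have s2 : oddPart P 2 = u ^ 2 - v ^ 2 := hP.oddPart_eq 2 1 2 (by norm_num)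
  have s1 : oddPart P 1 = u ^ 1 - v ^ 1 := hP.oddPart_eq 1 1 1 (by norm_num)
  have row : ∀ i : Fin l, (u + v) * y (i + 1) = y i + y (i + 2) := by
    intro i
    have h1 := hc i
    simp only [← extendVec_succ c] at h1
    rw [sum_fin_tridiagonal (extendVec_zero c) (extendVec_end c) i
      (A := oddPart P 2) (B := oddPart P (-1)) (C := oddPart P (-1)), oddPart_neg, s1, s2] at h1
    · refine mul_left_cancel₀ (pow_sub_pow_ne_zero huv hu1 one_pos) ?_
      linear_combination h1
    all_goals intros; rw [hf]; grind [oddPart_zero]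
  have hch := chain_eq huv (extendVec_zero c) (L := l + 1) fun j hj => row ⟨j, by omega⟩
  have hy1 : y 1 = 0 := by
    have := hch (l + 1) le_rfl
    rw [extendVec_end, mul_zero] at this
    exact (mul_eq_zero.mp this.symm).resolve_left (pow_sub_pow_ne_zero huv hu1 (by omega))
  exact eq_zero_of_extendVec fun j hj =>
    eq_zero_of_chain huv hu1 hch hy1 (j + 1) (by omega)

/-- The long rows give `q`-integers in `u²`, where `u` is the square root of `P 1` supplied by `P (1
/ 2)`. The last row equates the last two entries, and the difference of the two `q`-integers has the
factor `u ^ (2n+3) + v ^ (2n+3)`. -/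
theorem eq_zero_of_form_B (hP : IsGenericExp P) {l : ℕ} (hl : 2 ≤ l) (f : Fin l → Fin l → ℚ)
    (hf : ∀ i j, f i j = if (i : ℕ) = j then (if (i : ℕ) + 1 = l then 1 else 2)
      else if (i : ℕ) + 1 = j ∨ (j : ℕ) + 1 = i then -1 else 0)
    (c : Fin l → ℂ) (hc : ∀ i, ∑ j, oddPart P (f i j) * c j = 0) : c = 0 := by
  obtain ⟨n, rfl⟩ := Nat.exists_eq_add_of_le' hl
  set y := extendVec c with hy
  set u := P (1 / 2) with hu
  set v := P (-(1 / 2)) with hv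
  have huv : u * v = 1 := hP.mul_neg _
  have hu1 : ∀ n : ℕ, 0 < n → u ^ n ≠ 1 := hP.pow_ne_one (by norm_num)
  have huv2 : u ^ 2 * v ^ 2 = 1 := by rw [← mul_pow, huv, one_pow]
  have hu2 : ∀ n : ℕ, 0 < n → (u ^ 2) ^ n ≠ 1 := fun n hn => by
    rw [← pow_mul]; exact hu1 _ (by omega)
  have s2 : oddPart P 2 = u ^ 4 - v ^ 4 := hP.oddPart_eq 2 _ 4 (by norm_num)
  have s1 : oddPart P 1 = u ^ 2 - v ^ 2 := hP.oddPart_eq 1 _ 2 (by norm_num)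
  have row : ∀ i : Fin (n + 2), (i : ℕ) ≤ n →
      (u ^ 2 + v ^ 2) * y (i + 1) = y i + y (i + 2) := by
    intro i hi
    have h1 := hc i
    simp only [← extendVec_succ c] at h1
    rw [sum_fin_tridiagonal (extendVec_zero c) (extendVec_end c) i
      (A := oddPart P 2) (B := oddPart P (-1)) (C := oddPart P (-1)), oddPart_neg, s1, s2] at h1
    · refine mul_left_cancel₀ (pow_sub_pow_ne_zero huv hu1 two_pos) ?_
      linear_combination h1
    all_goals intros; rw [hf]; grind [oddPart_zero]
  have last : y (n + 2) = y (n + 1) := by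
    have h1 := hc ⟨n + 1, by omega⟩
    simp only [← extendVec_succ c] at h1
    rw [sum_fin_tridiagonal (extendVec_zero c) (extendVec_end c) ⟨n + 1, by omega⟩
      (A := oddPart P 1) (B := 0) (C := oddPart P (-1)), oddPart_neg, s1] at h1
    · refine mul_left_cancel₀ (pow_sub_pow_ne_zero huv hu1 two_pos) ?_
      linear_combination h1
    all_goals intros; rw [hf]; grind [oddPart_zero]
  have hch := chain_eq huv2 (extendVec_zero c) (L := n + 2) fun j hj =>
    row ⟨j, by omega⟩ (by simpa using hj)
  have hy1 : y 1 = 0 := by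
    have h1 := hch (n + 2) le_rfl
    have h2 := hch (n + 1) (by omega)
    have h3 : ((u ^ (2 * n + 3) + v ^ (2 * n + 3)) * (u ^ 1 - v ^ 1)) * y 1 = 0 := by
      linear_combination h2 - h1 + (u ^ 2 - v ^ 2) * last
        - (u ^ (2 * n + 2) - v ^ (2 * n + 2)) * y 1 * huv
    exact (mul_eq_zero.mp h3).resolve_left (mul_ne_zero
      (pow_add_pow_ne_zero huv hu1 (by omega)) (pow_sub_pow_ne_zero huv hu1 one_pos))
  exact eq_zero_of_extendVec fun j hj =>
    eq_zero_of_chain huv2 hu2 hch hy1 (j + 1) (by omega)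

/-- The short rows give `q`-integers in `u`. The two rows at the double bond close the system;
eliminating `y (n + 2)` leaves the factor `u ^ (n+3) + v ^ (n+3)`. -/
theorem eq_zero_of_form_C (hP : IsGenericExp P) {l : ℕ} (hl : 2 ≤ l) (f : Fin l → Fin l → ℚ)
    (hf : ∀ i j, f i j = if (i : ℕ) = j then (if (i : ℕ) + 1 = l then 2 else 1)
      else if (i : ℕ) + 1 = j ∨ (j : ℕ) + 1 = i then
        (if (i : ℕ) + 1 = l ∨ (j : ℕ) + 1 = l then -1 else -(1 / 2)) else 0)
    (c : Fin l → ℂ) (hc : ∀ i, ∑ j, oddPart P (f i j) * c j = 0) : c = 0 := by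
  obtain ⟨n, rfl⟩ := Nat.exists_eq_add_of_le' hl
  set y := extendVec c with hy
  set u := P (1 / 2) with hu
  set v := P (-(1 / 2)) with hv
  have huv : u * v = 1 := hP.mul_neg _
  have hu1 : ∀ n : ℕ, 0 < n → u ^ n ≠ 1 := hP.pow_ne_one (by norm_num)
  have s2 : oddPart P 2 = u ^ 4 - v ^ 4 := hP.oddPart_eq 2 _ 4 (by norm_num)
  have s1 : oddPart P 1 = u ^ 2 - v ^ 2 := hP.oddPart_eq 1 _ 2 (by norm_num)
  have sh : oddPart P (1 / 2) = u ^ 1 - v ^ 1 := hP.oddPart_eq (1 / 2) _ 1 (by norm_num)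
  have row : ∀ i : Fin (n + 2), (i : ℕ) < n →
      (u + v) * y (i + 1) = y i + y (i + 2) := by
    intro i hi
    have h1 := hc i
    simp only [← extendVec_succ c] at h1
    rw [sum_fin_tridiagonal (extendVec_zero c) (extendVec_end c) i
      (A := oddPart P 1) (B := oddPart P (-(1 / 2))) (C := oddPart P (-(1 / 2))), oddPart_neg, s1,
      sh] at h1
    · refine mul_left_cancel₀ (pow_sub_pow_ne_zero huv hu1 one_pos) ?_
      linear_combination h1
    all_goals intros; rw [hf]; grind [oddPart_zero]
  have row' : (u + v) * y (n + 1) = y n + (u + v) * y (n + 2) := by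
    have h1 := hc ⟨n, by omega⟩
    simp only [← extendVec_succ c] at h1
    rw [sum_fin_tridiagonal (extendVec_zero c) (extendVec_end c) ⟨n, by omega⟩
      (A := oddPart P 1) (B := oddPart P (-1)) (C := oddPart P (-(1 / 2))), oddPart_neg, oddPart_neg,
      s1, sh] at h1
    · refine mul_left_cancel₀ (pow_sub_pow_ne_zero huv hu1 one_pos) ?_
      linear_combination h1
    all_goals intros; rw [hf]; grind [oddPart_zero]
  have last : (u ^ 2 + v ^ 2) * y (n + 2) = y (n + 1) := by
    have h1 := hc ⟨n + 1, by omega⟩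
    simp only [← extendVec_succ c] at h1
    rw [sum_fin_tridiagonal (extendVec_zero c) (extendVec_end c) ⟨n + 1, by omega⟩
      (A := oddPart P 2) (B := 0) (C := oddPart P (-1)), oddPart_neg, s1, s2] at h1
    · refine mul_left_cancel₀ (pow_sub_pow_ne_zero huv hu1 two_pos) ?_
      linear_combination h1
    all_goals intros; rw [hf]; grind [oddPart_zero]
  have hch := chain_eq huv (extendVec_zero c) (L := n + 1) fun j hj =>
    row ⟨j, by omega⟩ (by simpa using hj)
  have hy1 : y 1 = 0 := by
    have h1 := hch (n + 1) le_rfl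
    have h2 := hch n (by omega)
    have h3 : ((u ^ (n + 3) + v ^ (n + 3)) * (u ^ 1 - v ^ 1)) * y 1 = 0 := by
      linear_combination (-(u ^ 2 + v ^ 2 - 1) * (u + v)) * h1 + (u ^ 2 + v ^ 2) * h2
        + (u - v) * ((u ^ 2 + v ^ 2) * row' + (u + v) * last)
        - (u ^ n * (2 * u ^ 2 + u * v + v ^ 2) - v ^ n * (u ^ 2 + u * v + 2 * v ^ 2)) * y 1 * huv
    exact (mul_eq_zero.mp h3).resolve_left (mul_ne_zero
      (pow_add_pow_ne_zero huv hu1 (by omega)) (pow_sub_pow_ne_zero huv hu1 one_pos))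
  have hz := eq_zero_of_chain huv hu1 hch hy1
  refine eq_zero_of_extendVec fun j hj => ?_
  by_cases hjn : j ≤ n
  · exact hz (j + 1) (by omega)
  · obtain rfl : j = n + 1 := by omega
    have := last
    rw [hy, hz (n + 1) le_rfl] at this
    exact (mul_eq_zero.mp this).resolve_left (pow_add_pow_ne_zero huv hu1 two_pos)

/-- For rows near the fork of type `D`, which are not tridiagonal. Unused slots take coefficient `0`
at any admissible index. -/
theorem sum_fin_eq_of_ite {l : ℕ} {y : ℕ → ℂ} {g : Fin l → ℂ} {A B C D : ℂ} {m₁ m₂ m₃ m₄ : ℕ}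
    (h1 : m₁ < l) (h2 : m₂ < l) (h3 : m₃ < l) (h4 : m₄ < l)
    (hg : ∀ j : Fin l, g j = (if (j : ℕ) = m₁ then A else 0) + (if (j : ℕ) = m₂ then B else 0)
      + (if (j : ℕ) = m₃ then C else 0) + (if (j : ℕ) = m₄ then D else 0)) :
    ∑ j, g j * y (j + 1) = A * y (m₁ + 1) + B * y (m₂ + 1) + C * y (m₃ + 1) + D * y (m₄ + 1) := by
  have key : ∀ (j : Fin l) (K : ℂ) (m : ℕ), (if (j : ℕ) = m then K else 0) * y (j + 1)
      = if (j : ℕ) = m then K * y (m + 1) else 0 := by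
    intro j K m
    split_ifs with h
    · rw [h]
    · exact zero_mul _
  have e : ∀ j : Fin l, g j * y (j + 1) = (if (j : ℕ) = m₁ then A * y (m₁ + 1) else 0)
      + (if (j : ℕ) = m₂ then B * y (m₂ + 1) else 0) + (if (j : ℕ) = m₃ then C * y (m₃ + 1) else 0)
      + (if (j : ℕ) = m₄ then D * y (m₄ + 1) else 0) := by
    intro j
    rw [hg, add_mul, add_mul, add_mul, key, key, key, key]
  simp only [e, Finset.sum_add_distrib, sum_fin_ite_eq, if_pos h1, if_pos h2, if_pos h3, if_pos h4]

/-- The chain gives `q`-integers up to the branch node; eliminating its two end neighbours leaves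
the factor `u ^ (n+3) + v ^ (n+3)`. -/
theorem eq_zero_of_form_D (hP : IsGenericExp P) {l : ℕ} (hl : 4 ≤ l) (f : Fin l → Fin l → ℚ)
    (hf : ∀ i j, f i j = if (i : ℕ) = j then 2
      else if ((i : ℕ) + 1 = j ∧ (j : ℕ) + 2 < l) ∨ ((j : ℕ) + 1 = i ∧ (i : ℕ) + 2 < l) ∨
        ((i : ℕ) + 3 = l ∧ ((j : ℕ) + 2 = l ∨ (j : ℕ) + 1 = l)) ∨
        ((j : ℕ) + 3 = l ∧ ((i : ℕ) + 2 = l ∨ (i : ℕ) + 1 = l)) then -1 else 0)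
    (c : Fin l → ℂ) (hc : ∀ i, ∑ j, oddPart P (f i j) * c j = 0) : c = 0 := by
  obtain ⟨n, rfl⟩ := Nat.exists_eq_add_of_le' hl
  set y := extendVec c with hy
  set u := P 1 with hu
  set v := P (-1) with hv
  have huv : u * v = 1 := hP.mul_neg _
  have hu1 : ∀ n : ℕ, 0 < n → u ^ n ≠ 1 := hP.pow_ne_one (by norm_num)
  have s2 : oddPart P 2 = u ^ 2 - v ^ 2 := hP.oddPart_eq 2 _ 2 (by norm_num)
  have s1 : oddPart P 1 = u ^ 1 - v ^ 1 := hP.oddPart_eq 1 _ 1 (by norm_num)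
  have hd := pow_sub_pow_ne_zero huv hu1 one_pos
  have row : ∀ i : Fin (n + 4), (i : ℕ) ≤ n →
      (u + v) * y (i + 1) = y i + y (i + 2) := by
    intro i hi
    have h1 := hc i
    simp only [← extendVec_succ c] at h1
    rw [sum_fin_tridiagonal (extendVec_zero c) (extendVec_end c) i
      (A := oddPart P 2) (B := oddPart P (-1)) (C := oddPart P (-1)), oddPart_neg, s1, s2] at h1
    · refine mul_left_cancel₀ hd ?_
      linear_combination h1
    all_goals intros; rw [hf]; grind [oddPart_zero]
  have row₁ : (u + v) * y (n + 2) = y (n + 1) + y (n + 3) + y (n + 4) := by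
    have h1 := hc ⟨n + 1, by omega⟩
    simp only [← extendVec_succ c] at h1
    rw [sum_fin_eq_of_ite (m₁ := n + 1) (m₂ := n) (m₃ := n + 2) (m₄ := n + 3)
      (A := oddPart P 2) (B := oddPart P (-1)) (C := oddPart P (-1)) (D := oddPart P (-1))
      (by omega) (by omega) (by omega) (by omega), oddPart_neg, s1, s2] at h1
    · refine mul_left_cancel₀ hd ?_
      linear_combination h1
    · intro j; rw [hf]; grind [oddPart_zero]
  have row₂ : (u + v) * y (n + 3) = y (n + 2) := by
    have h1 := hc ⟨n + 2, by omega⟩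
    simp only [← extendVec_succ c] at h1
    rw [sum_fin_eq_of_ite (m₁ := n + 2) (m₂ := n + 1) (m₃ := n) (m₄ := n)
      (A := oddPart P 2) (B := oddPart P (-1)) (C := 0) (D := 0)
      (by omega) (by omega) (by omega) (by omega), oddPart_neg, s1, s2] at h1
    · refine mul_left_cancel₀ hd ?_
      linear_combination h1
    · intro j; rw [hf]; grind [oddPart_zero]
  have row₃ : (u + v) * y (n + 4) = y (n + 2) := by
    have h1 := hc ⟨n + 3, by omega⟩
    simp only [← extendVec_succ c] at h1
    rw [sum_fin_eq_of_ite (m₁ := n + 3) (m₂ := n + 1) (m₃ := n) (m₄ := n)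
      (A := oddPart P 2) (B := oddPart P (-1)) (C := 0) (D := 0)
      (by omega) (by omega) (by omega) (by omega), oddPart_neg, s1, s2] at h1
    · refine mul_left_cancel₀ hd ?_
      linear_combination h1
    · intro j; rw [hf]; grind [oddPart_zero]
  have ht : u + v ≠ 0 := by simpa using pow_add_pow_ne_zero huv hu1 one_pos
  have hch := chain_eq huv (extendVec_zero c) (L := n + 2) fun j hj =>
    row ⟨j, by omega⟩ (by simpa using hj)
  have hy1 : y 1 = 0 := by
    have h1 := hch (n + 2) le_rfl
    have h2 := hch (n + 1) (by omega)
    have h3 : ((u ^ (n + 3) + v ^ (n + 3)) * (u ^ 1 - v ^ 1)) * y 1 = 0 := by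
      linear_combination (2 - (u + v) ^ 2) * h1 + (u + v) * h2
        + (u - v) * ((u + v) * row₁ + row₂ + row₃)
        - (u ^ n * (3 * u ^ 2 + u * v) - v ^ n * (3 * v ^ 2 + u * v)) * y 1 * huv
    exact (mul_eq_zero.mp h3).resolve_left (mul_ne_zero
      (pow_add_pow_ne_zero huv hu1 (by omega)) hd)
  have hz := eq_zero_of_chain huv hu1 hch hy1
  refine eq_zero_of_extendVec fun j hj => ?_
  by_cases hjn : j ≤ n + 1
  · exact hz (j + 1) (by omega)
  · have h0 : y (n + 2) = 0 := hz (n + 2) le_rfl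
    rw [h0] at row₂ row₃
    obtain rfl | rfl : j = n + 2 ∨ j = n + 3 := by omega
    · exact (mul_eq_zero.mp row₂).resolve_left ht
    · exact (mul_eq_zero.mp row₃).resolve_left ht

/-! ### The exceptional types. -/

section Exceptional

variable {u v : ℂ}

theorem add_ne_zero_of_generic (huv : u * v = 1) (hu : ∀ n : ℕ, 0 < n → u ^ n ≠ 1) :
    u + v ≠ 0 := by
  simpa using pow_add_pow_ne_zero huv hu one_pos

theorem add_sq_sub_one_ne_zero (huv : u * v = 1) (hu : ∀ n : ℕ, 0 < n → u ^ n ≠ 1) :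
    (u + v) ^ 2 - 1 ≠ 0 := by
  intro h
  apply pow_sub_pow_ne_zero huv hu (n := 3) (by norm_num)
  linear_combination (u - v) * h - (u - v) * huv

/-- The two short arms at the branch node of a diagram of type `E`. -/
theorem branch_eq {t c₀ c₁ c₂ b n : ℂ} (r₀ : t * c₀ = c₂) (r₁ : t * c₁ = b)
    (r₂ : t * c₂ = c₀ + b) (r₃ : t * b = c₁ + c₂ + n) :
    (t ^ 4 - 3 * t ^ 2 + 1) * b = t * (t ^ 2 - 1) * n := by
  linear_combination t * (t ^ 2 - 1) * r₃ + (t ^ 2 - 1) * r₁ + t * r₀ + t ^ 2 * r₂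

theorem arms_eq_zero {t c₀ c₁ c₂ b : ℂ} (ht : t ≠ 0) (ht1 : t ^ 2 - 1 ≠ 0) (r₀ : t * c₀ = c₂)
    (r₁ : t * c₁ = b) (r₂ : t * c₂ = c₀ + b) (hb : b = 0) : c₀ = 0 ∧ c₁ = 0 ∧ c₂ = 0 := by
  have h0 : c₀ = 0 := (mul_eq_zero.mp (show (t ^ 2 - 1) * c₀ = 0 by
    linear_combination t * r₀ + r₂ + hb)).resolve_left ht1
  exact ⟨h0, (mul_eq_zero.mp (r₁.trans hb)).resolve_left ht, by rw [← r₀, h0, mul_zero]⟩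

end Exceptional

/-- Divided by `u - v`, each row says that `t = u + v` times an entry is the sum of the neighbouring
entries. Solving inward from the free end of the long arm and comparing with `branch_eq` leaves `t²
- 1` times `u⁴ + v⁴ - 1`. -/
theorem eq_zero_of_form_E6 (hP : IsGenericExp P) (c : Fin 6 → ℂ)
    (hc : ∀ i : Fin 6, ∑ j : Fin 6, oddPart P (DynkinType.E6.form i j) * c j = 0) : c = 0 := by
  have r : ∀ i : Fin 6, ∑ j : Fin 6, oddPart P (1 * ((CartanMatrix.E₆ j i : ℤ) : ℚ)) * c j = 0 :=
    hc
  set u := P 1 with hu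
  set v := P (-1) with hv
  have huv : u * v = 1 := hP.mul_neg _
  have hu1 : ∀ n : ℕ, 0 < n → u ^ n ≠ 1 := hP.pow_ne_one (by norm_num)
  have s2 : oddPart P 2 = u ^ 2 - v ^ 2 := hP.oddPart_eq 2 _ 2 (by norm_num)
  have s1 : oddPart P 1 = u ^ 1 - v ^ 1 := hP.oddPart_eq 1 _ 1 (by norm_num)
  have hd := pow_sub_pow_ne_zero huv hu1 one_pos
  have ht := add_ne_zero_of_generic huv hu1
  have ht1 := add_sq_sub_one_ne_zero huv hu1
  have r0 : (u + v) * c 0 = c 2 := by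
    have := r 0
    simp [Fin.sum_univ_succ, CartanMatrix.E₆, oddPart_neg, s1, s2] at this
    exact mul_left_cancel₀ hd (by linear_combination this)
  have r1 : (u + v) * c 1 = c 3 := by
    have := r 1
    simp [Fin.sum_univ_succ, CartanMatrix.E₆, oddPart_neg, s1, s2] at this
    exact mul_left_cancel₀ hd (by linear_combination this)
  have r2 : (u + v) * c 2 = c 0 + c 3 := by
    have := r 2
    simp [Fin.sum_univ_succ, CartanMatrix.E₆, oddPart_neg, s1, s2] at this
    exact mul_left_cancel₀ hd (by linear_combination this)
  have r3 : (u + v) * c 3 = c 1 + c 2 + c 4 := by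
    have := r 3
    simp [Fin.sum_univ_succ, CartanMatrix.E₆, oddPart_neg, s1, s2] at this
    exact mul_left_cancel₀ hd (by linear_combination this)
  have r4 : (u + v) * c 4 = c 3 + c 5 := by
    have := r 4
    simp [Fin.sum_univ_succ, CartanMatrix.E₆, oddPart_neg, s1, s2] at this
    exact mul_left_cancel₀ hd (by linear_combination this)
  have r5 : (u + v) * c 5 = c 4 := by
    have := r 5
    simp [Fin.sum_univ_succ, CartanMatrix.E₆, oddPart_neg, s1, s2] at this
    exact mul_left_cancel₀ hd (by linear_combination this)
  generalize htdef : u + v = t at *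
  have h4 : c 4 = t * c 5 := by linear_combination -r5
  have h3 : c 3 = (t ^ 2 - 1) * c 5 := by linear_combination -r4 + t * h4
  have hb := branch_eq r0 r1 r2 r3
  have hx : (t ^ 2 - 1) * (u ^ 4 + v ^ 4 - 1) * c 5 = 0 := by
    have e : u ^ 4 + v ^ 4 - 1 = t ^ 4 - 4 * t ^ 2 + 1 := by
      rw [← htdef]
      linear_combination (8 - 6 * u * v - 6 - 4 * u ^ 2 - 4 * v ^ 2) * huv
    rw [h3, h4] at hb
    rw [e]
    linear_combination hb
  have hx0 := (mul_eq_zero.mp hx).resolve_left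
    (mul_ne_zero ht1 (pow_add_pow_sub_one_ne_zero huv hu1 (by norm_num)))
  rw [hx0, mul_zero] at h3 h4
  obtain ⟨a0, a1, a2⟩ := arms_eq_zero ht ht1 r0 r1 r2 h3
  funext i
  fin_cases i
  exacts [a0, a1, a2, h3, h4, hx0]

/-- The elimination of type `E6`, with one more node on the long arm; the remaining factor is `t (u⁶
+ v⁶ - 1)`. -/
theorem eq_zero_of_form_E7 (hP : IsGenericExp P) (c : Fin 7 → ℂ)
    (hc : ∀ i : Fin 7, ∑ j : Fin 7, oddPart P (DynkinType.E7.form i j) * c j = 0) : c = 0 := by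
  have r : ∀ i : Fin 7, ∑ j : Fin 7, oddPart P (1 * ((CartanMatrix.E₇ j i : ℤ) : ℚ)) * c j = 0 :=
    hc
  set u := P 1 with hu
  set v := P (-1) with hv
  have huv : u * v = 1 := hP.mul_neg _
  have hu1 : ∀ n : ℕ, 0 < n → u ^ n ≠ 1 := hP.pow_ne_one (by norm_num)
  have s2 : oddPart P 2 = u ^ 2 - v ^ 2 := hP.oddPart_eq 2 _ 2 (by norm_num)
  have s1 : oddPart P 1 = u ^ 1 - v ^ 1 := hP.oddPart_eq 1 _ 1 (by norm_num)
  have hd := pow_sub_pow_ne_zero huv hu1 one_pos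
  have ht := add_ne_zero_of_generic huv hu1
  have ht1 := add_sq_sub_one_ne_zero huv hu1
  have r0 : (u + v) * c 0 = c 2 := by
    have := r 0
    simp [Fin.sum_univ_succ, CartanMatrix.E₇, oddPart_neg, s1, s2] at this
    exact mul_left_cancel₀ hd (by linear_combination this)
  have r1 : (u + v) * c 1 = c 3 := by
    have := r 1
    simp [Fin.sum_univ_succ, CartanMatrix.E₇, oddPart_neg, s1, s2] at this
    exact mul_left_cancel₀ hd (by linear_combination this)
  have r2 : (u + v) * c 2 = c 0 + c 3 := by
    have := r 2
    simp [Fin.sum_univ_succ, CartanMatrix.E₇, oddPart_neg, s1, s2] at this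
    exact mul_left_cancel₀ hd (by linear_combination this)
  have r3 : (u + v) * c 3 = c 1 + c 2 + c 4 := by
    have := r 3
    simp [Fin.sum_univ_succ, CartanMatrix.E₇, oddPart_neg, s1, s2] at this
    exact mul_left_cancel₀ hd (by linear_combination this)
  have r4 : (u + v) * c 4 = c 3 + c 5 := by
    have := r 4
    simp [Fin.sum_univ_succ, CartanMatrix.E₇, oddPart_neg, s1, s2] at this
    exact mul_left_cancel₀ hd (by linear_combination this)
  have r5 : (u + v) * c 5 = c 4 + c 6 := by
    have := r 5
    simp [Fin.sum_univ_succ, CartanMatrix.E₇, oddPart_neg, s1, s2] at this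
    exact mul_left_cancel₀ hd (by linear_combination this)
  have r6 : (u + v) * c 6 = c 5 := by
    have := r 6
    simp [Fin.sum_univ_succ, CartanMatrix.E₇, oddPart_neg, s1, s2] at this
    exact mul_left_cancel₀ hd (by linear_combination this)
  generalize htdef : u + v = t at *
  have h5 : c 5 = t * c 6 := by linear_combination -r6
  have h4 : c 4 = (t ^ 2 - 1) * c 6 := by linear_combination -r5 + t * h5
  have h3 : c 3 = (t ^ 3 - 2 * t) * c 6 := by linear_combination -r4 + t * h4 - h5
  have hb := branch_eq r0 r1 r2 r3
  have hx : t * (u ^ 6 + v ^ 6 - 1) * c 6 = 0 := by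
    have e : u ^ 6 + v ^ 6 - 1 = t ^ 6 - 6 * t ^ 4 + 9 * t ^ 2 - 3 := by
      have hu0 : u ≠ 0 := left_ne_zero_of_mul_eq_one huv
      rw [← htdef, eq_inv_of_mul_eq_one_right huv]
      field_simp
      ring
    rw [h3, h4] at hb
    rw [e]
    linear_combination hb
  have hx0 := (mul_eq_zero.mp hx).resolve_left
    (mul_ne_zero ht (pow_add_pow_sub_one_ne_zero huv hu1 (by norm_num)))
  rw [hx0, mul_zero] at h3 h4 h5
  obtain ⟨a0, a1, a2⟩ := arms_eq_zero ht ht1 r0 r1 r2 h3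
  funext i
  fin_cases i
  exacts [a0, a1, a2, h3, h4, h5, hx0]

theorem eq_zero_of_form_E8 (hP : IsGenericExp P) (c : Fin 8 → ℂ)
    (hc : ∀ i : Fin 8, ∑ j : Fin 8, oddPart P (DynkinType.E8.form i j) * c j = 0) : c = 0 := by
  have r : ∀ i : Fin 8, ∑ j : Fin 8, oddPart P (1 * ((CartanMatrix.E₈ j i : ℤ) : ℚ)) * c j = 0 :=
    hc
  set u := P 1 with hu
  set v := P (-1) with hv
  have huv : u * v = 1 := hP.mul_neg _
  have hu1 : ∀ n : ℕ, 0 < n → u ^ n ≠ 1 := hP.pow_ne_one (by norm_num)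
  have s2 : oddPart P 2 = u ^ 2 - v ^ 2 := hP.oddPart_eq 2 _ 2 (by norm_num)
  have s1 : oddPart P 1 = u ^ 1 - v ^ 1 := hP.oddPart_eq 1 _ 1 (by norm_num)
  have hd := pow_sub_pow_ne_zero huv hu1 one_pos
  have ht := add_ne_zero_of_generic huv hu1
  have ht1 := add_sq_sub_one_ne_zero huv hu1
  have r0 : (u + v) * c 0 = c 2 := by
    have := r 0
    simp [Fin.sum_univ_succ, CartanMatrix.E₈, oddPart_neg, s1, s2] at this
    exact mul_left_cancel₀ hd (by linear_combination this)
  have r1 : (u + v) * c 1 = c 3 := by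
    have := r 1
    simp [Fin.sum_univ_succ, CartanMatrix.E₈, oddPart_neg, s1, s2] at this
    exact mul_left_cancel₀ hd (by linear_combination this)
  have r2 : (u + v) * c 2 = c 0 + c 3 := by
    have := r 2
    simp [Fin.sum_univ_succ, CartanMatrix.E₈, oddPart_neg, s1, s2] at this
    exact mul_left_cancel₀ hd (by linear_combination this)
  have r3 : (u + v) * c 3 = c 1 + c 2 + c 4 := by
    have := r 3
    simp [Fin.sum_univ_succ, CartanMatrix.E₈, oddPart_neg, s1, s2] at this
    exact mul_left_cancel₀ hd (by linear_combination this)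
  have r4 : (u + v) * c 4 = c 3 + c 5 := by
    have := r 4
    simp [Fin.sum_univ_succ, CartanMatrix.E₈, oddPart_neg, s1, s2] at this
    exact mul_left_cancel₀ hd (by linear_combination this)
  have r5 : (u + v) * c 5 = c 4 + c 6 := by
    have := r 5
    simp [Fin.sum_univ_succ, CartanMatrix.E₈, oddPart_neg, s1, s2] at this
    exact mul_left_cancel₀ hd (by linear_combination this)
  have r6 : (u + v) * c 6 = c 5 + c 7 := by
    have := r 6
    simp [Fin.sum_univ_succ, CartanMatrix.E₈, oddPart_neg, s1, s2] at this
    exact mul_left_cancel₀ hd (by linear_combination this)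
  have r7 : (u + v) * c 7 = c 6 := by
    have := r 7
    simp [Fin.sum_univ_succ, CartanMatrix.E₈, oddPart_neg, s1, s2] at this
    exact mul_left_cancel₀ hd (by linear_combination this)
  generalize htdef : u + v = t at *
  have h6 : c 6 = t * c 7 := by linear_combination -r7
  have h5 : c 5 = (t ^ 2 - 1) * c 7 := by linear_combination -r6 + t * h6
  have h4 : c 4 = (t ^ 3 - 2 * t) * c 7 := by linear_combination -r5 + t * h5 - h6
  have h3 : c 3 = (t ^ 4 - 3 * t ^ 2 + 1) * c 7 := by linear_combination -r4 + t * h4 - h5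
  have hb := branch_eq r0 r1 r2 r3
  -- The elimination leaves a polynomial of degree `8` in `t` not of the form `u ^ n + v ^ n - 1`;
  -- the extra factor `t² - 3 = u² + v² - 1` brings it to that form.
  have hx : (u ^ 10 + v ^ 10 - 1) * c 7 = 0 := by
    have e : u ^ 10 + v ^ 10 - 1
        = (t ^ 8 - 7 * t ^ 6 + 14 * t ^ 4 - 8 * t ^ 2 + 1) * (t ^ 2 - 3) := by
      have hu0 : u ≠ 0 := left_ne_zero_of_mul_eq_one huv
      rw [← htdef, eq_inv_of_mul_eq_one_right huv]
      field_simp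
      ring
    rw [h3, h4] at hb
    rw [e]
    linear_combination (t ^ 2 - 3) * hb
  have hx0 := (mul_eq_zero.mp hx).resolve_left
    (pow_add_pow_sub_one_ne_zero huv hu1 (by norm_num))
  rw [hx0, mul_zero] at h3 h4 h5 h6
  obtain ⟨a0, a1, a2⟩ := arms_eq_zero ht ht1 r0 r1 r2 h3
  funext i
  fin_cases i
  exacts [a0, a1, a2, h3, h4, h5, h6, hx0]

/-- The two long rows express `c 1` and `c 2` through `c 0`; the two short rows then leave the
factor `u⁶ + v⁶ - 1` in the square root `u` of `P 1`. -/
theorem eq_zero_of_form_F4 (hP : IsGenericExp P) (c : Fin 4 → ℂ)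
    (hc : ∀ i : Fin 4, ∑ j : Fin 4, oddPart P (DynkinType.F4.form i j) * c j = 0) : c = 0 := by
  have r : ∀ i : Fin 4, ∑ j : Fin 4, oddPart P
      ((![1, 1, 1 / 2, 1 / 2] : Fin 4 → ℚ) i * ((CartanMatrix.F₄ j i : ℤ) : ℚ)) * c j = 0 := hc
  set u := P (1 / 2) with hu
  set v := P (-(1 / 2)) with hv
  have huv : u * v = 1 := hP.mul_neg _
  have hu1 : ∀ n : ℕ, 0 < n → u ^ n ≠ 1 := hP.pow_ne_one (by norm_num)
  have s2 : oddPart P 2 = u ^ 4 - v ^ 4 := hP.oddPart_eq 2 _ 4 (by norm_num)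
  have s1 : oddPart P 1 = u ^ 2 - v ^ 2 := hP.oddPart_eq 1 _ 2 (by norm_num)
  have sh : oddPart P 2⁻¹ = u ^ 1 - v ^ 1 := hP.oddPart_eq 2⁻¹ _ 1 (by norm_num)
  have hd := pow_sub_pow_ne_zero huv hu1 one_pos
  have hd2 := pow_sub_pow_ne_zero huv hu1 two_pos
  have ht := add_ne_zero_of_generic huv hu1
  have r0 : (u ^ 2 + v ^ 2) * c 0 = c 1 := by
    have := r 0
    simp [Fin.sum_univ_succ, CartanMatrix.F₄, oddPart_neg, s1, s2] at this
    exact mul_left_cancel₀ hd2 (by linear_combination this)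
  have r1 : (u ^ 2 + v ^ 2) * c 1 = c 0 + c 2 := by
    have := r 1
    simp [Fin.sum_univ_succ, CartanMatrix.F₄, oddPart_neg, s1, s2] at this
    exact mul_left_cancel₀ hd2 (by linear_combination this)
  have r2 : (u + v) * c 2 = (u + v) * c 1 + c 3 := by
    have := r 2
    simp [Fin.sum_univ_succ, CartanMatrix.F₄, oddPart_neg, s1, sh] at this
    exact mul_left_cancel₀ hd (by linear_combination this)
  have r3 : (u + v) * c 3 = c 2 := by
    have := r 3
    simp [Fin.sum_univ_succ, CartanMatrix.F₄, oddPart_neg, s1, sh] at this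
    exact mul_left_cancel₀ hd (by linear_combination this)
  have h2 : c 2 = ((u ^ 2 + v ^ 2) ^ 2 - 1) * c 0 := by
    linear_combination -(u ^ 2 + v ^ 2) * r0 - r1
  have hx : (u ^ 6 + v ^ 6 - 1) * c 0 = 0 := by
    have e : u ^ 6 + v ^ 6 - 1
        = ((u + v) ^ 2 - 1) * ((u ^ 2 + v ^ 2) ^ 2 - 1) - (u + v) ^ 2 * (u ^ 2 + v ^ 2) := by
      have hu0 : u ≠ 0 := left_ne_zero_of_mul_eq_one huv
      rw [eq_inv_of_mul_eq_one_right huv]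
      field_simp
      ring
    rw [e]
    linear_combination (u + v) * r2 + r3 - ((u + v) ^ 2 - 1) * h2 - (u + v) ^ 2 * r0
  have h0 := (mul_eq_zero.mp hx).resolve_left
    (pow_add_pow_sub_one_ne_zero huv hu1 (by norm_num))
  rw [h0, mul_zero] at r0 h2
  rw [h2] at r3
  funext i
  fin_cases i
  exacts [h0, r0.symm, h2, (mul_eq_zero.mp r3).resolve_left ht]

/-- In the cube root `u` of `P 1`, eliminating `c 1` leaves `(u - v)(u⁴ + v⁴ - 1)`. -/
theorem eq_zero_of_form_G2 (hP : IsGenericExp P) (c : Fin 2 → ℂ)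
    (hc : ∀ i : Fin 2, ∑ j : Fin 2, oddPart P (DynkinType.G2.form i j) * c j = 0) : c = 0 := by
  have r : ∀ i : Fin 2, ∑ j : Fin 2, oddPart P
      ((![1, 1 / 3] : Fin 2 → ℚ) i * ((CartanMatrix.G₂ j i : ℤ) : ℚ)) * c j = 0 := hc
  set u := P (1 / 3) with hu
  set v := P (-(1 / 3)) with hv
  have huv : u * v = 1 := hP.mul_neg _
  have hu1 : ∀ n : ℕ, 0 < n → u ^ n ≠ 1 := hP.pow_ne_one (by norm_num)
  have s2 : oddPart P 2 = u ^ 6 - v ^ 6 := hP.oddPart_eq 2 _ 6 (by norm_num)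
  have s1 : oddPart P 1 = u ^ 3 - v ^ 3 := hP.oddPart_eq 1 _ 3 (by norm_num)
  have st : oddPart P (3⁻¹ * 2) = u ^ 2 - v ^ 2 := hP.oddPart_eq (3⁻¹ * 2) _ 2 (by norm_num)
  have hd := pow_sub_pow_ne_zero huv hu1 one_pos
  have hd3 := pow_sub_pow_ne_zero huv hu1 three_pos
  have r0 : (u ^ 3 + v ^ 3) * c 0 = c 1 := by
    have := r 0
    simp [Fin.sum_univ_succ, CartanMatrix.G₂, oddPart_neg, s1, s2] at this
    exact mul_left_cancel₀ hd3 (by linear_combination this)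
  have r1 : (u ^ 3 - v ^ 3) * c 0 = (u ^ 2 - v ^ 2) * c 1 := by
    have := r 1
    simp [Fin.sum_univ_succ, CartanMatrix.G₂, oddPart_neg, s1, st] at this
    linear_combination -this
  have hx : (u ^ 1 - v ^ 1) * (u ^ 4 + v ^ 4 - 1) * c 0 = 0 := by
    have e : (u ^ 1 - v ^ 1) * (u ^ 4 + v ^ 4 - 1)
        = (u ^ 2 - v ^ 2) * (u ^ 3 + v ^ 3) - (u ^ 3 - v ^ 3) := by
      have hu0 : u ≠ 0 := left_ne_zero_of_mul_eq_one huv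
      rw [eq_inv_of_mul_eq_one_right huv]
      field_simp
      ring
    rw [e]
    linear_combination (u ^ 2 - v ^ 2) * r0 - r1
  have h0 := (mul_eq_zero.mp hx).resolve_left
    (mul_ne_zero hd (pow_add_pow_sub_one_ne_zero huv hu1 (by norm_num)))
  rw [h0, mul_zero] at r0
  funext i
  fin_cases i
  exacts [h0, r0.symm]

/-- The `q`-deformed symmetrized Cartan matrices of finite type have trivial kernel. -/
theorem eq_zero_of_form (hP : IsGenericExp P) (T : DynkinType) (c : Fin T.rank → ℂ)
    (hc : ∀ i, ∑ j, oddPart P (T.form i j) * c j = 0) : c = 0 := by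
  cases T with
  | A l hl =>
    refine eq_zero_of_form_A hP (l := l) (DynkinType.A l hl).form
      (fun (i j : Fin l) => ?_) c hc
    change (1 : ℚ) * (((CartanMatrix.A l).transpose i j : ℤ) : ℚ) = _
    rw [CartanMatrix.A_transpose, CartanMatrix.A, Matrix.of_apply]
    simp only [Fin.ext_iff]
    split_ifs <;> norm_num
  | B l hl =>
    refine eq_zero_of_form_B hP (l := l) (by omega) (DynkinType.B l hl).form
      (fun (i j : Fin l) => ?_) c hc
    change (if i.val + 1 = l then (1 / 2 : ℚ) else 1)
      * (((CartanMatrix.B l).transpose i j : ℤ) : ℚ) = _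
    rw [CartanMatrix.B_transpose, CartanMatrix.C, Matrix.of_apply]
    simp only [Fin.ext_iff]
    split_ifs <;> first | omega | norm_num
  | C l hl =>
    refine eq_zero_of_form_C hP (l := l) (by omega) (DynkinType.C l hl).form
      (fun (i j : Fin l) => ?_) c hc
    change (if i.val + 1 = l then (1 : ℚ) else 1 / 2)
      * (((CartanMatrix.C l).transpose i j : ℤ) : ℚ) = _
    rw [CartanMatrix.C_transpose, CartanMatrix.B, Matrix.of_apply]
    simp only [Fin.ext_iff]
    split_ifs <;> first | omega | norm_num
  | D l hl =>
    refine eq_zero_of_form_D hP (l := l) hl (DynkinType.D l hl).form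
      (fun (i j : Fin l) => ?_) c hc
    change (1 : ℚ) * (((CartanMatrix.D l).transpose i j : ℤ) : ℚ) = _
    rw [CartanMatrix.D_transpose, CartanMatrix.D, Matrix.of_apply]
    simp only [Fin.ext_iff]
    split_ifs <;> first | omega | norm_num
  | E6 => exact eq_zero_of_form_E6 hP c hc
  | E7 => exact eq_zero_of_form_E7 hP c hc
  | E8 => exact eq_zero_of_form_E8 hP c hc
  | F4 => exact eq_zero_of_form_F4 hP c hc
  | G2 => exact eq_zero_of_form_G2 hP c hc

end Nondegenerate

/-! ### Gradings by the eigenspaces of an operator -/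

section Grading

variable {V : Type*} [AddCommGroup V] [Module ℂ V]

/-- The filtration attached to an operator `D`: the sum of those eigenspaces whose eigenvalue `c`
satisfies `V_{c + n} = 0` for `n ≥ M`. -/
def eigenFiltration (D : Module.End ℂ V) (M : ℤ) : Submodule ℂ V :=
  ⨆ (c : ℂ) (_ : ∀ n : ℤ, M ≤ n → D.eigenspace (c + n) = ⊥), D.eigenspace c

/-- For `M ≤ 0` the condition on an eigenvalue includes `n = 0`, so only zero eigenspaces enter;
exhaustion is the boundedness of degrees. -/
theorem isTruncFiltration_eigenFiltration {D : Module.End ℂ V} (hgr : (⨆ a : ℂ, D.eigenspace a) = ⊤)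
    (htr : ∀ a : ℂ, ∃ n₀ : ℕ, ∀ n : ℕ, n₀ < n → D.eigenspace (a + n) = ⊥) :
    IsTruncFiltration (eigenFiltration D) where
  mono M M' hM := iSup_mono fun c => iSup_le fun hc =>
    le_iSup_of_le (fun n hn => hc n (hM.trans hn)) le_rfl
  eq_bot M hM := by
    refine eq_bot_iff.mpr (iSup_le fun c => iSup_le fun hc => ?_)
    simpa using (hc 0 hM).le
  exhaust v := by
    have hmono : Monotone (eigenFiltration D) := fun M M' hM => iSup_mono fun c => iSup_le fun hc =>
      le_iSup_of_le (fun n hn => hc n (hM.trans hn)) le_rfl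
    have hv : v ∈ ⨆ a : ℂ, D.eigenspace a := by rw [hgr]; trivial
    refine Submodule.iSup_induction (motive := fun v => ∃ M : ℕ, v ∈ eigenFiltration D M) _ hv
      ?_ ?_ ?_
    · intro c x hx
      obtain ⟨n₀, hn₀⟩ := htr c
      refine ⟨n₀ + 1, Submodule.mem_iSup_of_mem c (Submodule.mem_iSup_of_mem (fun n hn => ?_) hx)⟩
      obtain ⟨t, rfl⟩ := Int.eq_ofNat_of_zero_le (show 0 ≤ n by omega)
      exact hn₀ t (by omega)
    · exact ⟨0, zero_mem _⟩
    · rintro x y ⟨M, hM⟩ ⟨N, hN⟩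
      exact ⟨max M N, add_mem (hmono (by omega) hM) (hmono (by omega) hN)⟩

theorem mem_eigenspace_of_commutator {D f : Module.End ℂ V} {n c : ℂ} (hf : D * f - f * D = n • f)
    {v : V} (hv : v ∈ D.eigenspace c) : f v ∈ D.eigenspace (c + n) := by
  rw [Module.End.mem_eigenspace_iff] at hv ⊢
  have := LinearMap.congr_fun hf v
  rw [LinearMap.sub_apply, Module.End.mul_apply, Module.End.mul_apply, hv, map_smul,
    LinearMap.smul_apply, sub_eq_iff_eq_add] at this
  rw [this, add_smul, add_comm]

theorem mem_degSub_of_commutator {D f : Module.End ℂ V} {n : ℤ}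
    (hf : D * f - f * D = (n : ℂ) • f) : f ∈ degSub (eigenFiltration D) n := by
  intro M v hv
  suffices h : eigenFiltration D M ≤ (eigenFiltration D (M - n)).comap f from h hv
  refine iSup_le fun c => iSup_le fun hc x hx => ?_
  refine Submodule.mem_iSup_of_mem (c + n) (Submodule.mem_iSup_of_mem (fun n' hn' => ?_)
    (mem_eigenspace_of_commutator hf hx))
  have := hc (n + n') (by omega)
  rwa [Int.cast_add, ← add_assoc] at this

/-! ### Irreducibility without the grading operator. -/

section Monomials

variable {κ : Type*} (g : κ → Module.End ℂ V) (deg : κ → ℤ)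

/-- The subspace spanned by the images of the vectors in `s` under all monomials in the operators
`g y`. -/
def orbitSpan (s : Set V) : Submodule ℂ V :=
  Submodule.span ℂ {w | ∃ L : List κ, ∃ v ∈ s, (L.map g).prod v = w}

theorem mem_stabSub_orbitSpan (s : Set V) (y : κ) : g y ∈ stabSub (orbitSpan g s) := by
  intro w hw
  induction hw using Submodule.span_induction with
  | mem x hx =>
    obtain ⟨L, v, hv, rfl⟩ := hx
    exact Submodule.subset_span ⟨y :: L, v, hv, by simp⟩
  | zero => simp
  | add x y _ _ hx hy => rw [map_add]; exact add_mem hx hy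
  | smul c x _ hx => rw [map_smul]; exact Submodule.smul_mem _ _ hx

theorem subset_orbitSpan (s : Set V) : s ⊆ orbitSpan g s := fun v hv =>
  Submodule.subset_span ⟨[], v, hv, by simp⟩

variable {g} in
theorem orbitSpan_le {S : Submodule ℂ V} (hS : ∀ y, g y ∈ stabSub S) {s : Set V} (hs : s ⊆ S) :
    orbitSpan g s ≤ S := by
  refine Submodule.span_le.mpr ?_
  rintro _ ⟨L, v, hv, rfl⟩
  induction L with
  | nil => simpa using hs hv
  | cons y L ih => simpa using hS y _ ih

variable {g deg} {D : Module.End ℂ V}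

theorem commutator_prod (hg : ∀ y, D * g y - g y * D = (deg y : ℂ) • g y) (L : List κ) :
    D * (L.map g).prod - (L.map g).prod * D = (((L.map deg).sum : ℤ) : ℂ) • (L.map g).prod := by
  induction L with
  | nil => simp
  | cons y L ih =>
    simp only [List.map_cons, List.prod_cons, List.sum_cons]
    have e : D * (g y * (L.map g).prod) - g y * (L.map g).prod * D
        = (D * g y - g y * D) * (L.map g).prod
          + g y * (D * (L.map g).prod - (L.map g).prod * D) := by noncomm_ring
    rw [e, hg, ih, smul_mul_assoc, mul_smul_comm, ← add_smul]
    push_cast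
    rfl

/-- Suppose that no proper nonzero subspace is stable under `D` and the homogeneous operators
`g y`.  Then no proper nonzero subspace is stable under the `g y` alone. -/
theorem eq_top_of_stable_of_graded (hgr : (⨆ a : ℂ, D.eigenspace a) = ⊤)
    (htr : ∀ a : ℂ, ∃ n₀ : ℕ, ∀ n : ℕ, n₀ < n → D.eigenspace (a + n) = ⊥)
    (hg : ∀ y, D * g y - g y * D = (deg y : ℂ) • g y)
    (hirr : ∀ S : Submodule ℂ V, S ≠ ⊥ → (∀ y, g y ∈ stabSub S) → D ∈ stabSub S → S = ⊤)
    {S : Submodule ℂ V} (hS : S ≠ ⊥) (hSg : ∀ y, g y ∈ stabSub S) : S = ⊤ := by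
  have hF := isTruncFiltration_eigenFiltration hgr htr
  -- By minimality every monomial of positive degree kills `v`. The aim is to show that `v` is
  -- homogeneous.
  obtain ⟨M, v, hvS, hvM, hv0, hmin⟩ := hF.exists_minimal hS
  have hpos : ∀ L : List κ, 0 < (L.map deg).sum → (L.map g).prod v = 0 := fun L hL =>
    hmin _ hL _ (orbitSpan_le hSg (Set.singleton_subset_iff.mpr hvS)
      (Submodule.subset_span ⟨L, v, rfl, rfl⟩))
      (mem_degSub_of_commutator (commutator_prod hg L) _ _ hvM)
  -- Monomials applied to a homogeneous vector are homogeneous, so the orbit is stable under `D` and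
  -- the graded hypothesis applies.
  have horb : ∀ c : ℂ, ∀ w ∈ D.eigenspace c, w ≠ 0 → orbitSpan g {w} = ⊤ := by
    intro c w hw hw0
    refine hirr _ (fun h => hw0 ?_) (mem_stabSub_orbitSpan g {w}) ?_
    · have := subset_orbitSpan g {w} rfl
      rw [h] at this
      exact this
    · intro x hx
      induction hx using Submodule.span_induction with
      | mem x hx =>
        obtain ⟨L, _, rfl, rfl⟩ := hx
        have := mem_eigenspace_of_commutator (commutator_prod hg L) hw
        rw [Module.End.mem_eigenspace_iff] at this
        simp only [this]
        exact Submodule.smul_mem _ _ (Submodule.subset_span ⟨L, _, rfl, rfl⟩)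
      | zero => simp
      | add x y _ _ hx hy => rw [map_add]; exact add_mem hx hy
      | smul c x _ hx => rw [map_smul]; exact Submodule.smul_mem _ _ hx
  have hvt : v ∈ ⨆ a : ℂ, D.eigenspace a := by rw [hgr]; trivial
  obtain ⟨f, hf, hfv⟩ := (Submodule.mem_iSup_iff_exists_finsupp _ _).mp hvt
  have hind := D.eigenspaces_iSupIndep
  -- A monomial shifts all eigenvalues by the same amount, so the images of the components of `v`
  -- stay independent and vanish separately.
  have hcomp : ∀ c, ∀ L : List κ, 0 < (L.map deg).sum → (L.map g).prod (f c) = 0 := by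
    intro c L hL
    have hind' := hind.comp (add_left_injective (((L.map deg).sum : ℤ) : ℂ))
    rw [iSupIndep_iff_finsetSum_eq_zero_imp_eq_zero] at hind'
    by_cases hc : c ∈ f.support
    · refine hind' f.support (fun c => (L.map g).prod (f c)) (fun c _ =>
        mem_eigenspace_of_commutator (commutator_prod hg L) (hf c)) ?_ c hc
      rw [← map_sum, ← hpos L hL, ← hfv]
      rfl
    · rw [Finsupp.notMem_support_iff.mp hc, map_zero]
  -- Each nonzero component generates `V` through monomials of degree at most `0`, so any other
  -- component has degree lower by a natural number. By symmetry there is only one component.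
  have hdeg : ∀ c, f c ≠ 0 → ∀ c', f c' ≠ 0 → ∃ n : ℕ, c' = c - n := by
    intro c hc c' hc'
    by_contra! hne
    have hle : (⊤ : Submodule ℂ V) ≤ ⨆ j, ⨆ _ : j ≠ c', D.eigenspace j := by
      rw [← horb c (f c) (hf c) hc]
      refine Submodule.span_le.mpr ?_
      rintro _ ⟨L, _, rfl, rfl⟩
      by_cases hL : 0 < (L.map deg).sum
      · simp only [hcomp c L hL]
        exact zero_mem _
      · refine Submodule.mem_iSup_of_mem _ (Submodule.mem_iSup_of_mem ?_
          (mem_eigenspace_of_commutator (commutator_prod hg L) (hf c)))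
        obtain ⟨n, hn⟩ := Int.eq_ofNat_of_zero_le (show 0 ≤ -(L.map deg).sum by omega)
        rintro rfl
        refine hne n ?_
        rw [show (L.map deg).sum = -(n : ℤ) by omega]
        push_cast
        ring
    have hdis := (hind c').mono_right hle
    rw [disjoint_top] at hdis
    have := hf c'
    rw [hdis] at this
    exact hc' this
  obtain ⟨c, hc⟩ : ∃ c, f c ≠ 0 := by
    by_contra! h0
    exact hv0 (by rw [← hfv]; simp [Finsupp.sum, h0])
  have hvc : v = f c := by
    rw [← hfv]
    refine Finsupp.sum_eq_single c (fun c' hc' hne => absurd ?_ hne) (fun _ => rfl)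
    obtain ⟨n, hn⟩ := hdeg c hc c' hc'
    obtain ⟨n', hn'⟩ := hdeg c' hc' c hc
    have : ((n + n' : ℕ) : ℂ) = 0 := by push_cast; linear_combination hn + hn'
    have : n = 0 := by have := Nat.cast_eq_zero.mp this; omega
    rw [hn, this, Nat.cast_zero, sub_zero]
  rw [eq_top_iff, ← horb c v (hvc ▸ hf c) hv0]
  exact orbitSpan_le hSg (Set.singleton_subset_iff.mpr hvS)

end Monomials

end Grading

/-! ### `q`-numbers -/

section QNumbers

variable {h : ℂ}

theorem qpow_zero (h : ℂ) : qpow h 0 = 1 := by simp [qpow]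

theorem qpow_add (h : ℂ) (x y : ℚ) : qpow h (x + y) = qpow h x * qpow h y := by
  simp only [qpow, ← Complex.exp_add]
  congr 1
  push_cast
  ring

theorem qpow_ne_zero (h : ℂ) (x : ℚ) : qpow h x ≠ 0 := Complex.exp_ne_zero _

/-- If `q ^ x = 1`, raising to the denominator of `x` shows that a nonzero integral power of `q` is
`1`. -/
theorem isGenericExp_qpow (hq : ∀ n : ℕ, 0 < n → Complex.exp h ^ n ≠ 1) :
    IsGenericExp (qpow h) where
  zero := qpow_zero h
  add := qpow_add h
  ne_one x hx h1 := by
    have key : Complex.exp (((x.num : ℤ) : ℂ) * h) = 1 := by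
      have h2 : qpow h x ^ x.den = 1 := by rw [h1, one_pow]
      rw [qpow, ← Complex.exp_nat_mul] at h2
      rw [← h2]
      congr 1
      have h3 : ((x.den : ℚ) * x : ℚ) = x.num := by rw [mul_comm]; exact Rat.mul_den_eq_num x
      have h4 : ((x.den : ℂ) * (x : ℂ)) = (x.num : ℂ) := by
        exact_mod_cast congrArg (Rat.cast (K := ℂ)) h3
      rw [← mul_assoc, h4]
    have key2 : Complex.exp h ^ x.num.natAbs = 1 := by
      rw [← Complex.exp_nat_mul]
      rcases Int.natAbs_eq x.num with hn | hn
      · rwa [hn, Int.cast_natCast] at key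
      · rwa [hn, Int.cast_neg, Int.cast_natCast, neg_mul, Complex.exp_neg, inv_eq_one] at key
    exact hq _ (Int.natAbs_pos.mpr (Rat.num_ne_zero.mpr hx)) key2

theorem IsGenericExp.comp_mul {P : ℚ → ℂ} (hP : IsGenericExp P) {m : ℚ} (hm : m ≠ 0) :
    IsGenericExp fun x => P (x * m) where
  zero := by simp [hP.zero]
  add x y := by rw [add_mul, hP.add]
  ne_one x hx := hP.ne_one _ (mul_ne_zero hx hm)

theorem IsGenericExp.oddPart_ne_zero {P : ℚ → ℂ} (hP : IsGenericExp P) {x : ℚ} (hx : x ≠ 0) :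
    oddPart P x ≠ 0 := by
  simpa [oddPart] using pow_sub_pow_ne_zero (hP.mul_neg x) (hP.pow_ne_one hx) one_pos

theorem qnum_ne_zero (hq : ∀ n : ℕ, 0 < n → Complex.exp h ^ n ≠ 1) {x : ℚ} (hx : x ≠ 0) :
    qnum h x ≠ 0 :=
  div_ne_zero ((isGenericExp_qpow hq).oddPart_ne_zero hx)
    ((isGenericExp_qpow hq).oddPart_ne_zero one_ne_zero)

theorem qnum_neg (h : ℂ) (x : ℚ) : qnum h (-x) = -qnum h x := by
  rw [qnum, qnum, neg_neg, ← neg_div, neg_sub]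

/-- The form `[a_i(m), a_j(-m)] = [(α_i|α_j) m] / m * [k m]` of the Heisenberg algebra at
level `k`. -/
def heisenbergForm (T : DynkinType) (h : ℂ) (k : ℚ) (m : ℕ) : Matrix (Fin T.rank) (Fin T.rank) ℂ :=
  fun i j => qnum h (T.form i j * m) / m * qnum h (k * m)

/-- Up to the nonzero factor `[k m] / m`, the matrix is the deformed Cartan matrix for the
exponential `x ↦ q ^ (x m)`, again generic since `m ≠ 0`. -/
theorem isUnit_det_heisenbergForm (T : DynkinType)
    (hq : ∀ n : ℕ, 0 < n → Complex.exp h ^ n ≠ 1) {k : ℚ} (hk : k ≠ 0) {m : ℕ} (hm : 0 < m) :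
    IsUnit (heisenbergForm T h k m).det := by
  rw [isUnit_iff_ne_zero, Ne, ← Matrix.exists_mulVec_eq_zero_iff]
  rintro ⟨c, hc0, hc⟩
  have hP := isGenericExp_qpow hq
  have hmQ : (m : ℚ) ≠ 0 := by exact_mod_cast hm.ne'
  have hmC : (m : ℂ) ≠ 0 := by exact_mod_cast hm.ne'
  refine hc0 (eq_zero_of_form (hP.comp_mul hmQ) T c fun i => ?_)
  have hi := congrFun hc i
  simp only [Matrix.mulVec, dotProduct, heisenbergForm, Pi.zero_apply] at hi
  have h1 : oddPart (qpow h) 1 ≠ 0 := hP.oddPart_ne_zero one_ne_zero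
  have hkm : qnum h (k * m) ≠ 0 := qnum_ne_zero hq (mul_ne_zero hk hmQ)
  have e : ∀ j, oddPart (fun x => qpow h (x * m)) (T.form i j) * c j
      = oddPart (qpow h) 1 * m / qnum h (k * m)
        * (qnum h (T.form i j * m) / m * qnum h (k * m) * c j) := by
    intro j
    have : qnum h (T.form i j * m)
        = oddPart (fun x => qpow h (x * m)) (T.form i j) / oddPart (qpow h) 1 := by
      simp [qnum, oddPart]
    rw [this]
    generalize oddPart _ (T.form i j) = s
    field_simp
  rw [Finset.sum_congr rfl fun j _ => e j, ← Finset.mul_sum, hi, mul_zero]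

end QNumbers

/-! ### The action of the generators on a module in the category -/

section Operators

variable {T : DynkinType} {h : ℂ} {k : ℚ} {V : Type*} [AddCommGroup V] [Module ℂ V]
  [Module (Uq T h) V] [IsScalarTower ℂ (Uq T h) V]

theorem op_eq_of_rel {u w : FreeAlgebra ℂ (Gen T.rank)} (hr : Rel T h u w) :
    op T h V u = op T h V w := by
  rw [op, op, Uq.mk, RingQuot.mkAlgHom_rel ℂ hr]

@[simp] theorem op_mul (u w : FreeAlgebra ℂ (Gen T.rank)) :
    op T h V (u * w) = op T h V u * op T h V w := by simp [op]

@[simp] theorem op_add (u w : FreeAlgebra ℂ (Gen T.rank)) :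
    op T h V (u + w) = op T h V u + op T h V w := by simp [op]

@[simp] theorem op_sub (u w : FreeAlgebra ℂ (Gen T.rank)) :
    op T h V (u - w) = op T h V u - op T h V w := by simp [op]

@[simp] theorem op_smul (c : ℂ) (u : FreeAlgebra ℂ (Gen T.rank)) :
    op T h V (c • u) = c • op T h V u := by simp [op]

@[simp] theorem op_one : op T h V 1 = 1 := by simp [op]

@[simp] theorem op_zero : op T h V 0 = 0 := by simp [op]

@[simp] theorem op_pow (u : FreeAlgebra ℂ (Gen T.rank)) (n : ℕ) :
    op T h V (u ^ n) = op T h V u ^ n := by simp [op]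

namespace InCategory

theorem op_ghInv (hV : InCategory T h k V) :
    op T h V (Free.g .ghInv) = qpow h (-(k / 2)) • (1 : Module.End ℂ V) := by
  have h1 := op_eq_of_rel (V := V) (Rel.gh_mul_inv (T := T) (h := h))
  rw [op_mul, op_one, hV.level, smul_mul_assoc, one_mul] at h1
  rw [← h1, smul_smul, ← qpow_add, neg_add_cancel, qpow_zero, one_smul]

theorem op_ghPow (hV : InCategory T h k V) (m : ℤ) :
    op T h V (Free.ghPow m) = qpow h (m * k / 2) • (1 : Module.End ℂ V) := by
  have hpow : ∀ (x : ℚ) (n : ℕ), qpow h x ^ n = qpow h (n * x) := by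
    intro x n
    induction n with
    | zero => simp [qpow_zero]
    | succ n ih => rw [pow_succ, ih, ← qpow_add]; congr 1; push_cast; ring
  rw [Free.ghPow]
  split_ifs with hm
  · obtain ⟨n, rfl⟩ := Int.eq_ofNat_of_zero_le hm
    rw [op_pow, hV.level, smul_pow, one_pow, hpow]
    congr 2
    simp
    ring
  · obtain ⟨n, hn⟩ := Int.eq_ofNat_of_zero_le (show 0 ≤ -m by omega)
    obtain rfl : m = -n := by omega
    rw [op_pow, hV.op_ghInv, smul_pow, one_pow, hpow]
    congr 2
    simp
    ring

theorem aOp_comm (hV : InCategory T h k V) (i j : Fin T.rank) {m n : ℤ} (hm : m ≠ 0) (hn : n ≠ 0) :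
    aOp T h V i m * aOp T h V j n - aOp T h V j n * aOp T h V i m
      = if m + n = 0 then (qnum h (T.form i j * m) / m * qnum h (k * m)) • 1 else 0 := by
  have h1 := op_eq_of_rel (V := V) (Rel.a_a (T := T) (h := h) i j m n hm hn)
  rw [op_sub, op_mul, op_mul] at h1
  rw [aOp, aOp, h1]
  split_ifs
  · rw [op_smul, op_sub, hV.op_ghPow, hV.op_ghPow, ← sub_smul, smul_smul]
    congr 1
    rw [qnum.eq_1 h (k * m), show ((2 * m : ℤ) : ℚ) * k / 2 = k * m by push_cast; ring,
      show ((-(2 * m) : ℤ) : ℚ) * k / 2 = -(k * m) by push_cast; ring]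
    ring
  · exact op_zero

theorem aOp_xOp_comm (hV : InCategory T h k V) (ε : ℤˣ) (i j : Fin T.rank) {m : ℤ} (hm : m ≠ 0)
    (n : ℤ) : aOp T h V i m * xOp T h V ε j n - xOp T h V ε j n * aOp T h V i m
      = (((ε : ℤ) : ℂ) * (qnum h (T.form i j * m) / m)
          * qpow h (-(((ε : ℤ) : ℚ) * k * |m| / 2))) • xOp T h V ε j (m + n) := by
  have h1 := op_eq_of_rel (V := V) (Rel.a_x (T := T) (h := h) ε i j m n hm)
  rw [op_sub, op_mul, op_mul, op_smul, op_mul, hV.op_ghPow, smul_mul_assoc, one_mul,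
    smul_smul] at h1
  rw [aOp, xOp, h1, xOp]
  congr 3
  push_cast
  ring

theorem dOp_commutator_aOp (i : Fin T.rank) (n : ℤ) :
    dOp T h V * aOp T h V i n - aOp T h V i n * dOp T h V = (n : ℂ) • aOp T h V i n := by
  by_cases hn : n = 0
  · subst hn
    simp [aOp, Free.a]
  · have h1 := op_eq_of_rel (V := V) (Rel.d_a (T := T) (h := h) i n hn)
    rwa [op_sub, op_mul, op_mul, op_smul] at h1

theorem dOp_commutator_xOp (ε : ℤˣ) (i : Fin T.rank) (n : ℤ) :
    dOp T h V * xOp T h V ε i n - xOp T h V ε i n * dOp T h V = (n : ℂ) • xOp T h V ε i n := by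
  have h1 := op_eq_of_rel (V := V) (Rel.d_x (T := T) (h := h) ε i n)
  rwa [op_sub, op_mul, op_mul, op_smul] at h1

end InCategory

/-- The degrees of the generators. -/
def Gen.deg {l : ℕ} : Gen l → ℤ
  | .a _ n _ => n
  | .x _ _ n => n
  | _ => 0

theorem InCategory.dOp_commutator (hV : InCategory T h k V) (y : Gen T.rank) :
    dOp T h V * op T h V (Free.g y) - op T h V (Free.g y) * dOp T h V
      = ((y.deg : ℤ) : ℂ) • op T h V (Free.g y) := by
  cases y with
  | gh => simp [hV.level, Gen.deg]
  | ghInv => simp [hV.op_ghInv, Gen.deg]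
  | k i =>
    have h1 := op_eq_of_rel (V := V) (Rel.k_d (T := T) (h := h) i)
    rw [op_mul, op_mul] at h1
    simp [dOp, h1, Gen.deg]
  | kInv i =>
    have h1 := op_eq_of_rel (V := V) (Rel.k_d (T := T) (h := h) i)
    have h2 := op_eq_of_rel (V := V) (Rel.k_mul_inv (T := T) (h := h) i)
    have h3 := op_eq_of_rel (V := V) (Rel.inv_mul_k (T := T) (h := h) i)
    rw [op_mul, op_mul] at h1
    rw [op_mul, op_one] at h2 h3
    have h4 : op T h V (Free.g (.kInv i)) * dOp T h V = dOp T h V * op T h V (Free.g (.kInv i)) := by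
      calc _ = op T h V (Free.g (.kInv i)) * (dOp T h V * op T h V (Free.g (.k i)))
            * op T h V (Free.g (.kInv i)) := by rw [mul_assoc, mul_assoc, h2, mul_one]
        _ = _ := by rw [dOp, ← h1, ← mul_assoc, h3, one_mul]
    simp [h4, Gen.deg]
  | d => simp [dOp, Gen.deg]
  | a i n hn =>
    have := InCategory.dOp_commutator_aOp (V := V) (h := h) i n
    rwa [aOp, Free.a, dif_pos hn] at this
  | x ε i n => exact InCategory.dOp_commutator_xOp ε i n

/-- The degree filtration of a module. -/
abbrev degFiltration (T : DynkinType) (h : ℂ) (V : Type*) [AddCommGroup V] [Module ℂ V]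
    [Module (Uq T h) V] [IsScalarTower ℂ (Uq T h) V] : ℤ → Submodule ℂ V :=
  eigenFiltration (dOp T h V)

theorem InCategory.isTruncFiltration (hV : InCategory T h k V) :
    IsTruncFiltration (degFiltration T h V) :=
  isTruncFiltration_eigenFiltration hV.graded hV.truncated

theorem InCategory.isHeisenberg (hV : InCategory T h k V)
    (hq : ∀ n : ℕ, 0 < n → Complex.exp h ^ n ≠ 1) (hk : k ≠ 0) :
    IsHeisenberg (degFiltration T h V) (aOp T h V) (heisenbergForm T h k) where
  filt := hV.isTruncFiltration
  deg i n := mem_degSub_of_commutator (InCategory.dOp_commutator_aOp i n)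
  comm_pos i j m n hm hn := by
    have := hV.aOp_comm i j (m := m) (n := n) (by omega) (by omega)
    rwa [if_neg (by omega), sub_eq_zero] at this
  comm_neg i j m n hm hn := by
    have := hV.aOp_comm i j (m := -m) (n := -n) (by omega) (by omega)
    rwa [if_neg (by omega), sub_eq_zero] at this
  comm i j m n hm hn := by
    have := hV.aOp_comm i j (m := m) (n := -n) (by omega) (by omega)
    rw [this]
    by_cases hmn : m = n
    · rw [if_pos (by omega), if_pos hmn]
      simp [heisenbergForm]
    · rw [if_neg (by omega), if_neg hmn]
  nondeg m hm := isUnit_det_heisenbergForm T hq hk hm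

end Operators

/-! ### The vacuum space and the quantum `Z`-operators -/

section ZOperators

variable {T : DynkinType} {h : ℂ} {k : ℚ} {V : Type*} [AddCommGroup V] [Module ℂ V]
  [Module (Uq T h) V] [IsScalarTower ℂ (Uq T h) V]

theorem mul_mem_stabSub {S : Submodule ℂ V} {f g : Module.End ℂ V} (hf : f ∈ stabSub S)
    (hg : g ∈ stabSub S) : f * g ∈ stabSub S := fun v hv => hf _ (hg v hv)

/-- The coefficients of `E_+^ε(η α_i, z)` lie in any multiplicative graded family of subspaces
of operators that contains the `a_i(n)`, `n > 0`. -/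
theorem coeff_EPlus_mem {A : ℕ → Submodule ℂ (Module.End ℂ V)} (h1 : 1 ∈ A 0)
    (hmul : ∀ {m n : ℕ} {f g : Module.End ℂ V}, f ∈ A m → g ∈ A n → f * g ∈ A (m + n))
    (ε η : ℤˣ) (i : Fin T.rank) (ha : ∀ n : ℕ, 0 < n → aOp T h V i n ∈ A n) (N : ℕ) :
    PowerSeries.coeff N (EPlus T h k V ε η i) ∈ A N := by
  refine coeff_expSeries_mem_of_graded h1 hmul (fun n => ?_) N
  rw [PowerSeries.coeff_mk]
  split_ifs with hn
  · exact zero_mem _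
  · exact Submodule.smul_mem _ _ (ha n (Nat.pos_of_ne_zero hn))

/-- The coefficients of `E_-^ε(α_i, z)` lie in any multiplicative graded family of subspaces
of operators that contains the `a_i(-n)`, `n > 0`. -/
theorem coeff_EMinus_mem {A : ℕ → Submodule ℂ (Module.End ℂ V)} (h1 : 1 ∈ A 0)
    (hmul : ∀ {m n : ℕ} {f g : Module.End ℂ V}, f ∈ A m → g ∈ A n → f * g ∈ A (m + n))
    (ε : ℤˣ) (i : Fin T.rank) (ha : ∀ n : ℕ, 0 < n → aOp T h V i (-n) ∈ A n) (N : ℕ) :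
    PowerSeries.coeff N (EMinus T h k V ε i) ∈ A N := by
  refine coeff_expSeries_mem_of_graded h1 hmul (fun n => ?_) N
  rw [PowerSeries.coeff_mk]
  split_ifs with hn
  · exact zero_mem _
  · exact Submodule.smul_mem _ _ (ha n (Nat.pos_of_ne_zero hn))

/-- The vacuum space is the common kernel of the `a_i(n)`, `n > 0`. -/
theorem vacuum_eq_vacuumOf (hq : ∀ n : ℕ, 0 < n → Complex.exp h ^ n ≠ 1) (hk : k ≠ 0) :
    vacuum T h k V = vacuumOf (aOp T h V) := by
  ext v
  rw [mem_vacuumOf]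
  constructor
  · intro hv i n
    induction n using Nat.strong_induction_on with
    | _ n ih =>
    intro hn
    have h1 := hv 1 1 i n
    rw [if_neg hn.ne', EPlus, expSeries, PowerSeries.coeff_mk, LinearMap.sum_apply,
      Finset.sum_eq_single_of_mem 1 (Finset.mem_range.mpr (by omega))] at h1
    · rw [pow_one, PowerSeries.coeff_mk, if_neg hn.ne', LinearMap.smul_apply, LinearMap.smul_apply,
        smul_smul] at h1
      refine (smul_eq_zero.mp h1).resolve_left ?_
      have hkn : qnum h (k * n) ≠ 0 :=
        qnum_ne_zero hq (mul_ne_zero hk (by exact_mod_cast hn.ne'))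
      simp [qpow_ne_zero, hkn]
    -- Only the linear term of the exponential survives: a product of two or more factors ends on
    -- the right with some `a_i(p)`, `p < n`, which kills `v` by induction.
    · intro j _ hj
      rw [LinearMap.smul_apply]
      match j, hj with
      | 0, _ =>
        rw [pow_zero, PowerSeries.coeff_one, if_neg hn.ne', LinearMap.zero_apply, smul_zero]
      | j + 2, _ =>
        rw [pow_succ, PowerSeries.coeff_mul, LinearMap.sum_apply, Finset.sum_eq_zero, smul_zero]
        intro p hp
        have hp' := Finset.HasAntidiagonal.mem_antidiagonal.mp hp
        rw [Module.End.mul_apply]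
        by_cases hpn : p.2 = n
        · rw [show p.1 = 0 by omega, coeff_pow_eq_zero_of_lt (by simp) (by omega),
            LinearMap.zero_apply]
        · rw [PowerSeries.coeff_mk]
          split_ifs with hp0
          · simp
          · rw [LinearMap.smul_apply, ih p.2 (by omega) (by omega), smul_zero, map_zero]
  · intro hv ε η i N
    rcases Nat.eq_zero_or_pos N with rfl | hN
    · rw [EPlus, coeff_zero_expSeries, if_pos rfl, Module.End.one_apply]
    rw [if_neg hN.ne']
    -- Operators that scale `v` in degree `0` and kill it in positive degrees form a multiplicative
    -- family containing the `a_i(n)`.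
    let A : ℕ → Submodule ℂ (Module.End ℂ V) := fun n =>
      (if n = 0 then Submodule.span ℂ {v} else ⊥).comap (LinearMap.applyₗ v)
    have hA : ∀ n (f : Module.End ℂ V), f ∈ A n ↔
        f v ∈ (if n = 0 then Submodule.span ℂ {v} else ⊥ : Submodule ℂ V) := fun _ _ => Iff.rfl
    have := coeff_EPlus_mem (T := T) (h := h) (k := k) (V := V) (A := A) ?_ ?_ ε η i ?_ N
    · rwa [hA, if_neg hN.ne'] at this
    · rw [hA, if_pos rfl]
      exact Submodule.mem_span_singleton_self v
    · intro m n f g hf hg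
      rw [hA] at hf hg ⊢
      rw [Module.End.mul_apply]
      by_cases hn : n = 0
      · subst hn
        rw [if_pos rfl, Submodule.mem_span_singleton] at hg
        obtain ⟨c, hc⟩ := hg
        rw [← hc, map_smul]
        exact Submodule.smul_mem _ _ hf
      · rw [if_neg hn, Submodule.mem_bot] at hg
        rw [hg, map_zero]
        exact zero_mem _
    · intro n hn
      rw [hA, hv i n hn]
      exact zero_mem _

theorem zOp_eq_dressSum (ε : ℤˣ) (i : Fin T.rank) (n : ℤ) (v : V) :
    ZOp T h k ε i n v = dressSum (fun p => PowerSeries.coeff p (EMinus T h k V ε i))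
      (xOp T h V ε i) (fun r => PowerSeries.coeff r (EPlus T h k V ε 1 i)) n v := rfl

theorem xOp_mem_degSub (ε : ℤˣ) (i : Fin T.rank) (n : ℤ) :
    xOp T h V ε i n ∈ degSub (degFiltration T h V) n :=
  mem_degSub_of_commutator (InCategory.dOp_commutator_xOp ε i n)

theorem coeff_EPlus_mem_degSub (ε η : ℤˣ) (i : Fin T.rank) (r : ℕ) :
    PowerSeries.coeff r (EPlus T h k V ε η i) ∈ degSub (degFiltration T h V) r := by
  refine coeff_EPlus_mem (A := fun n => degSub (degFiltration T h V) n) one_mem_degSub ?_ ε η i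
    (fun n _ => mem_degSub_of_commutator (InCategory.dOp_commutator_aOp i n)) r
  intro m n f g hf hg
  rw [Nat.cast_add]
  exact mul_mem_degSub hf hg

theorem zTerm_support_finite (hV : InCategory T h k V) (ε : ℤˣ) (i : Fin T.rank) (n : ℤ) (v : V) :
    (Function.support (ZTerm T h k ε i n v)).Finite :=
  dressTerm_support_finite (em := fun p => PowerSeries.coeff p (EMinus T h k V ε i))
    hV.isTruncFiltration (xOp_mem_degSub ε i) (coeff_EPlus_mem_degSub ε 1 i) n v

/-- The quantum `Z`-operators are linear. -/
def zLin (hV : InCategory T h k V) (ε : ℤˣ) (i : Fin T.rank) (n : ℤ) : Module.End ℂ V where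
  toFun := ZOp T h k ε i n
  map_add' := dressSum_add (em := fun p => PowerSeries.coeff p (EMinus T h k V ε i))
    hV.isTruncFiltration (xOp_mem_degSub ε i) (coeff_EPlus_mem_degSub ε 1 i) n
  map_smul' := dressSum_smul (em := fun p => PowerSeries.coeff p (EMinus T h k V ε i)) (x := xOp T h V ε i)
    (ep := fun r => PowerSeries.coeff r (EPlus T h k V ε 1 i)) n

/-- The `[k m]` of the Heisenberg relation cancels the denominator in the exponent, leaving exactly
the negative of the coefficient in `[a_j(m), x_i^ε(n)]`. -/
theorem aOp_pos_commutator_EMinus (hV : InCategory T h k V)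
    (hq : ∀ n : ℕ, 0 < n → Complex.exp h ^ n ≠ 1) (hk : k ≠ 0) (ε : ℤˣ) (i j : Fin T.rank) {m : ℕ}
    (hm : 0 < m) (p : ℕ) :
    aOp T h V j m * PowerSeries.coeff p (EMinus T h k V ε i)
      - PowerSeries.coeff p (EMinus T h k V ε i) * aOp T h V j m
      = if m ≤ p then (-(((ε : ℤ) : ℂ) * (qnum h (T.form j i * m) / m)
          * qpow h (-(((ε : ℤ) : ℚ) * k * m / 2)))) •
          PowerSeries.coeff (p - m) (EMinus T h k V ε i) else 0 := by
  refine commutator_coeff_expSeries (by simp) hm (fun n => ?_) p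
  rw [PowerSeries.coeff_mk]
  rcases Nat.eq_zero_or_pos n with rfl | hn
  · rw [if_pos rfl, if_neg hm.ne, mul_zero, zero_mul, sub_zero]
  rw [if_neg hn.ne', mul_smul_comm, smul_mul_assoc, ← smul_sub,
    hV.aOp_comm j i (by omega) (by omega)]
  by_cases hmn : n = m
  · subst hmn
    have hkn : qnum h (k * n) ≠ 0 := qnum_ne_zero hq (mul_ne_zero hk (by exact_mod_cast hn.ne'))
    rw [if_pos (by omega), if_pos rfl, smul_smul]
    congr 1
    push_cast
    field_simp
  · rw [if_neg (by omega), if_neg hmn, smul_zero]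

theorem aOp_pos_commutator_EPlus (hV : InCategory T h k V) (ε η : ℤˣ) (i j : Fin T.rank) {m : ℕ}
    (hm : 0 < m) (r : ℕ) :
    aOp T h V j m * PowerSeries.coeff r (EPlus T h k V ε η i)
      - PowerSeries.coeff r (EPlus T h k V ε η i) * aOp T h V j m = 0 := by
  have := commutator_coeff_expSeries (A := aOp T h V j m) (c := 0) (m := m) (by simp) hm
    (f := PowerSeries.mk fun n : ℕ => if n = 0 then 0 else
    (((ε : ℤ) : ℂ) * ((η : ℤ) : ℂ) *
      (qpow h (-(((ε : ℤ) : ℚ) * k * n / 2)) / qnum h (k * n))) • aOp T h V i (n : ℤ))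
    (fun n => ?_) r
  · rwa [zero_smul, ite_self] at this
  rw [PowerSeries.coeff_mk]
  rcases Nat.eq_zero_or_pos n with rfl | hn
  · simp
  · rw [if_neg hn.ne', mul_smul_comm, smul_mul_assoc, ← smul_sub,
      hV.aOp_comm j i (by omega) (by omega), if_neg (by omega)]
    simp

theorem aOp_neg_commutator_EMinus (hV : InCategory T h k V) (ε : ℤˣ) (i j : Fin T.rank) {m : ℕ}
    (hm : 0 < m) (p : ℕ) :
    aOp T h V j (-m) * PowerSeries.coeff p (EMinus T h k V ε i)
      - PowerSeries.coeff p (EMinus T h k V ε i) * aOp T h V j (-m) = 0 := by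
  have := commutator_coeff_expSeries (A := aOp T h V j (-m)) (c := 0) (m := m) (by simp) hm
    (f := PowerSeries.mk fun n : ℕ => if n = 0 then 0 else
    (-((ε : ℤ) : ℂ) *
      (qpow h (-(((ε : ℤ) : ℚ) * k * n / 2)) / qnum h (k * n))) • aOp T h V i (-(n : ℤ)))
    (fun n => ?_) p
  · rwa [zero_smul, ite_self] at this
  rw [PowerSeries.coeff_mk]
  rcases Nat.eq_zero_or_pos n with rfl | hn
  · simp
  · rw [if_neg hn.ne', mul_smul_comm, smul_mul_assoc, ← smul_sub,
      hV.aOp_comm j i (by omega) (by omega), if_neg (by omega)]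
    simp

/-- The same cancellation for `a_j(-m)`: of the three signs that change in its Heisenberg relation
one is left, which makes up for the opposite sign in the exponent of `E_+`. -/
theorem aOp_neg_commutator_EPlus (hV : InCategory T h k V)
    (hq : ∀ n : ℕ, 0 < n → Complex.exp h ^ n ≠ 1) (hk : k ≠ 0) (ε : ℤˣ) (i j : Fin T.rank) {m : ℕ}
    (hm : 0 < m) (r : ℕ) :
    aOp T h V j (-m) * PowerSeries.coeff r (EPlus T h k V ε 1 i)
      - PowerSeries.coeff r (EPlus T h k V ε 1 i) * aOp T h V j (-m)
      = if m ≤ r then (-(((ε : ℤ) : ℂ) * (qnum h (T.form j i * m) / m)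
          * qpow h (-(((ε : ℤ) : ℚ) * k * m / 2)))) •
          PowerSeries.coeff (r - m) (EPlus T h k V ε 1 i) else 0 := by
  refine commutator_coeff_expSeries (by simp) hm (fun n => ?_) r
  rw [PowerSeries.coeff_mk]
  rcases Nat.eq_zero_or_pos n with rfl | hn
  · rw [if_pos rfl, if_neg hm.ne, mul_zero, zero_mul, sub_zero]
  rw [if_neg hn.ne', mul_smul_comm, smul_mul_assoc, ← smul_sub,
    hV.aOp_comm j i (by omega) (by omega)]
  by_cases hmn : n = m
  · subst hmn
    have hkn : qnum h (k * n) ≠ 0 := qnum_ne_zero hq (mul_ne_zero hk (by exact_mod_cast hn.ne'))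
    rw [if_pos (by omega), if_pos rfl, smul_smul]
    congr 1
    push_cast
    rw [mul_neg, mul_neg, qnum_neg, qnum_neg]
    field_simp
  · rw [if_neg (by omega), if_neg hmn, smul_zero]

/-- The quantum `Z`-operators commute with the annihilation operators. -/
theorem aOp_pos_zOp (hV : InCategory T h k V) (hq : ∀ n : ℕ, 0 < n → Complex.exp h ^ n ≠ 1)
    (hk : k ≠ 0) (ε : ℤˣ) (i j : Fin T.rank) {m : ℕ} (hm : 0 < m) (n : ℤ) (v : V) :
    aOp T h V j m (ZOp T h k ε i n v) = ZOp T h k ε i n (aOp T h V j m v) := by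
  refine map_dressSum_of_pos hV.isTruncFiltration (xOp_mem_degSub ε i)
    (coeff_EPlus_mem_degSub ε 1 i) (aOp_pos_commutator_EMinus hV hq hk ε i j hm) (fun n => ?_)
    (aOp_pos_commutator_EPlus hV ε 1 i j hm) n v
  rw [hV.aOp_xOp_comm ε j i (by omega) n]
  simp

/-- The quantum `Z`-operators commute with the creation operators. -/
theorem aOp_neg_zOp (hV : InCategory T h k V) (hq : ∀ n : ℕ, 0 < n → Complex.exp h ^ n ≠ 1)
    (hk : k ≠ 0) (ε : ℤˣ) (i j : Fin T.rank) {m : ℕ} (hm : 0 < m) (n : ℤ) (v : V) :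
    aOp T h V j (-m) (ZOp T h k ε i n v) = ZOp T h k ε i n (aOp T h V j (-m) v) := by
  refine map_dressSum_of_neg hV.isTruncFiltration (xOp_mem_degSub ε i)
    (coeff_EPlus_mem_degSub ε 1 i) (aOp_neg_commutator_EMinus hV ε i j hm) (fun n => ?_)
    (aOp_neg_commutator_EPlus hV hq hk ε i j hm) n v
  rw [hV.aOp_xOp_comm ε j i (by omega) n]
  simp [qnum_neg]

theorem zStable_vacuum (hV : InCategory T h k V) (hq : ∀ n : ℕ, 0 < n → Complex.exp h ^ n ≠ 1)
    (hk : k ≠ 0) : ZStable T h k V (vacuum T h k V) := by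
  intro ε i n v hv
  rw [vacuum_eq_vacuumOf hq hk, mem_vacuumOf] at hv ⊢
  intro j m hm
  rw [aOp_pos_zOp hV hq hk ε i j hm, hv j m hm, zOp_eq_dressSum, dressSum_zero]

/-! ### Subspaces stable under the quantum affine algebra -/

/-- A subspace that is stable under all generators is a submodule. -/
def submoduleOfStable (S : Submodule ℂ V) (hS : ∀ y, op T h V (Free.g y) ∈ stabSub S) :
    Submodule (Uq T h) V where
  carrier := S
  add_mem' := S.add_mem
  zero_mem' := S.zero_mem
  smul_mem' c v hv := by
    obtain ⟨u, rfl⟩ := RingQuot.mkAlgHom_surjective ℂ (Rel T h) c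
    have hu : op T h V u ∈ stabSub S := by
      induction u using FreeAlgebra.induction with
      | grade0 r =>
        have : op T h V (algebraMap ℂ _ r) = r • 1 := by
          rw [Algebra.algebraMap_eq_smul_one, op_smul, op_one]
        rw [this]
        exact Submodule.smul_mem _ _ fun v hv => hv
      | grade1 y => exact hS y
      | mul a b ha hb => rw [op_mul]; exact mul_mem_stabSub ha hb
      | add a b ha hb => rw [op_add]; exact add_mem ha hb
    exact hu v hv

theorem eq_top_of_isSimpleModule [IsSimpleModule (Uq T h) V] {S : Submodule ℂ V} (hS : S ≠ ⊥)
    (hSy : ∀ y, op T h V (Free.g y) ∈ stabSub S) : S = ⊤ := by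
  rcases eq_bot_or_eq_top (submoduleOfStable S hSy) with h0 | h0
  · refine absurd ?_ hS
    rw [eq_bot_iff]
    intro v hv
    have : v ∈ submoduleOfStable S hSy := hv
    rw [h0] at this
    exact this
  · rw [eq_top_iff]
    intro v _
    have : v ∈ submoduleOfStable S hSy := by rw [h0]; trivial
    exact this

/-- In an irreducible module, a nonzero subspace stable under all generators except possibly `d`
is everything. -/
theorem InCategory.eq_top_of_stable (hV : InCategory T h k V) [IsSimpleModule (Uq T h) V]
    {S : Submodule ℂ V} (hS : S ≠ ⊥)
    (hSy : ∀ y, y ≠ Gen.d → op T h V (Free.g y) ∈ stabSub S) : S = ⊤ := by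
  refine eq_top_of_stable_of_graded (κ := {y : Gen T.rank // y ≠ Gen.d})
    (g := fun y => op T h V (Free.g y.1)) (deg := fun y => y.1.deg) hV.graded hV.truncated
    (fun y => hV.dOp_commutator y.1) (fun S hS hg hD =>
      eq_top_of_isSimpleModule (T := T) (h := h) hS fun y => ?_) hS
    (fun y => hSy y.1 y.2)
  by_cases hy : y = Gen.d
  · rw [hy]; exact hD
  · exact hg ⟨y, hy⟩

theorem DynkinType.halfSq_ne_zero (T : DynkinType) (i : Fin T.rank) : T.halfSq i ≠ 0 := by
  cases T with
  | B l hl =>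
    change (if (i : ℕ) + 1 = l then (1 / 2 : ℚ) else 1) ≠ 0
    split_ifs <;> norm_num
  | C l hl =>
    change (if (i : ℕ) + 1 = l then (1 : ℚ) else 1 / 2) ≠ 0
    split_ifs <;> norm_num
  | F4 =>
    have h : ∀ j : Fin 4, (![1, 1, 1 / 2, 1 / 2] : Fin 4 → ℚ) j ≠ 0 := by
      simp [Fin.forall_fin_succ]
    exact h i
  | G2 =>
    have h : ∀ j : Fin 2, (![1, 1 / 3] : Fin 2 → ℚ) j ≠ 0 := by
      simp [Fin.forall_fin_succ]
    exact h i
  | _ => exact one_ne_zero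

/-- The commutator `[x_i⁺(m), x_i⁻(-m)]` is a nonzero multiple of `q^{mk} k_i - q^{-mk} k_i⁻¹`. The
cases `m = 0, 1` are independent combinations, with determinant `q^k - q^{-k}` up to sign. -/
theorem kOp_mem_stabSub (hV : InCategory T h k V) (hq : ∀ n : ℕ, 0 < n → Complex.exp h ^ n ≠ 1)
    (hk : k ≠ 0) {S : Submodule ℂ V} (hx : ∀ ε i n, xOp T h V ε i n ∈ stabSub S)
    (i : Fin T.rank) : op T h V (Free.g (.k i)) ∈ stabSub S ∧
      op T h V (Free.g (.kInv i)) ∈ stabSub S := by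
  have hP := isGenericExp_qpow hq
  have hhalf := T.halfSq_ne_zero i
  have key : ∀ m : ℤ, qpow h (m * k) • op T h V (Free.g (.k i))
      - qpow h (-(m * k)) • op T h V (Free.g (.kInv i)) ∈ stabSub S := by
    intro m
    have h1 := op_eq_of_rel (V := V) (Rel.xp_xm (T := T) (h := h) i i m (-m))
    rw [if_pos rfl, add_neg_cancel, sub_neg_eq_add, ← two_mul, op_smul, op_sub, op_sub, op_mul,
      op_mul, op_mul, op_mul, hV.op_ghPow, hV.op_ghPow, Free.psi, if_pos le_rfl, Free.phi,
      if_pos le_rfl, Int.neg_zero, Int.toNat_zero, coeff_zero_expSeries, coeff_zero_expSeries,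
      mul_one, mul_one, smul_mul_assoc, smul_mul_assoc, one_mul, one_mul] at h1
    have h2 : op T h V (Free.x 1 i m) * op T h V (Free.x (-1) i (-m))
        - op T h V (Free.x (-1) i (-m)) * op T h V (Free.x 1 i m) ∈ stabSub S :=
      sub_mem (mul_mem_stabSub (hx 1 i m) (hx (-1) i (-m)))
        (mul_mem_stabSub (hx (-1) i (-m)) (hx 1 i m))
    have hd : (qpow h (T.halfSq i) - qpow h (-T.halfSq i))⁻¹ ≠ 0 :=
      inv_ne_zero (hP.oddPart_ne_zero hhalf)
    rw [h1, Submodule.smul_mem_iff _ hd] at h2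
    convert h2 using 3
    · congr 1; push_cast; ring
    · congr 1; push_cast; ring
  have h0 := key 0
  have h1 := key 1
  have hkk : oddPart (qpow h) k ≠ 0 := hP.oddPart_ne_zero hk
  simp only [Int.cast_zero, zero_mul, neg_zero, qpow_zero, one_smul, Int.cast_one, one_mul] at h0 h1
  constructor
  · refine (Submodule.smul_mem_iff _ hkk).mp ?_
    convert sub_mem h1 (Submodule.smul_mem _ (qpow h (-k)) h0) using 1
    rw [oddPart, sub_smul, smul_sub]
    abel
  · refine (Submodule.smul_mem_iff _ hkk).mp ?_
    convert sub_mem h1 (Submodule.smul_mem _ (qpow h k) h0) using 1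
    rw [oddPart, sub_smul, smul_sub]
    abel

/-! ### Irreducibility -/

/-- Every `Z`-stable subspace of the vacuum space of an irreducible module is trivial. -/
theorem eq_vacuum_of_zStable (hV : InCategory T h k V)
    (hq : ∀ n : ℕ, 0 < n → Complex.exp h ^ n ≠ 1) (hk : k ≠ 0) [IsSimpleModule (Uq T h) V]
    {W : Submodule ℂ V} (hW : W ≤ vacuum T h k V) (hWZ : ZStable T h k V W) (hW0 : W ≠ ⊥) :
    W = vacuum T h k V := by
  have H := hV.isHeisenberg hq hk
  rw [vacuum_eq_vacuumOf hq hk] at hW ⊢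
  set g : Fin T.rank × ℕ → Module.End ℂ V := fun y => aOp T h V y.1 (-(y.2 + 1 : ℕ)) with hg
  set S := orbitSpan g (W : Set V) with hSdef
  have hWS : W ≤ S := subset_orbitSpan g _
  have hneg : ∀ i, ∀ n : ℕ, 0 < n → aOp T h V i (-n) ∈ stabSub S := by
    intro i n hn
    have := mem_stabSub_orbitSpan g (W : Set V) (i, n - 1)
    simp only [hg] at this
    rwa [Nat.sub_add_cancel hn] at this
  have hpos : ∀ i, ∀ n : ℕ, 0 < n → aOp T h V i n ∈ stabSub S := by
    intro j m hm
    -- It is enough that the vectors of `S` sent into `S` contain `W`, where annihilators vanish,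
    -- and are stable under creators, which holds because the commutators are scalars.
    suffices hle : S ≤ S ⊓ S.comap (aOp T h V j m) from fun v hv => (hle hv).2
    refine orbitSpan_le (fun y v hv => ?_) (fun w hw => ⟨hWS hw, ?_⟩)
    · refine ⟨mem_stabSub_orbitSpan g _ y v hv.1, ?_⟩
      have h1 := LinearMap.congr_fun (H.comm j y.1 m (y.2 + 1) hm (Nat.succ_pos _)) v
      rw [LinearMap.sub_apply, Module.End.mul_apply, Module.End.mul_apply,
        sub_eq_iff_eq_add] at h1
      change aOp T h V j m (aOp T h V y.1 (-(y.2 + 1 : ℕ)) v) ∈ S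
      rw [h1]
      refine add_mem ?_ (hneg _ _ (Nat.succ_pos _) _ hv.2)
      split_ifs
      · exact Submodule.smul_mem _ _ hv.1
      · exact zero_mem _
    · change aOp T h V j m w ∈ S
      rw [mem_vacuumOf.mp (hW hw) j m hm]
      exact zero_mem _
  have hZ : ∀ ε i n, ∀ v ∈ S, ZOp T h k ε i n v ∈ S := by
    intro ε i n
    suffices hle : S ≤ S ⊓ S.comap (zLin hV ε i n) from fun v hv => (hle hv).2
    refine orbitSpan_le (fun y v hv => ?_) (fun w hw => ⟨hWS hw, hWS (hWZ ε i n w hw)⟩)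
    refine ⟨mem_stabSub_orbitSpan g _ y v hv.1, ?_⟩
    have h1 := aOp_neg_zOp hV hq hk ε i y.1 (Nat.succ_pos y.2) n v
    change ZOp T h k ε i n (aOp T h V y.1 (-(y.2 + 1 : ℕ)) v) ∈ S
    rw [← h1]
    exact hneg _ _ (Nat.succ_pos _) _ hv.2
  have hone : (1 : Module.End ℂ V) ∈ stabSub S := fun v hv => hv
  have hx : ∀ ε i n, xOp T h V ε i n ∈ stabSub S := fun ε i n =>
    mem_stabSub_of_dressSum_mem hV.isTruncFiltration (xOp_mem_degSub ε i)
      (coeff_EPlus_mem_degSub (k := k) ε 1 i) (coeff_zero_expSeries _) (coeff_zero_expSeries _)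
      (coeff_EMinus_mem (A := fun _ => stabSub S) hone mul_mem_stabSub ε i (hneg i))
      (coeff_EPlus_mem (A := fun _ => stabSub S) hone mul_mem_stabSub ε 1 i (hpos i))
      (hZ ε i) n
  have hS0 : S ≠ ⊥ := fun h0 => hW0 (eq_bot_iff.mpr (h0 ▸ hWS))
  have hStop : S = ⊤ := by
    -- Stability under `d` is not available, since `W` is not assumed graded.
    refine hV.eq_top_of_stable hS0 fun y hy => ?_
    cases y with
    | gh => rw [hV.level]; exact Submodule.smul_mem _ _ hone
    | ghInv => rw [hV.op_ghInv]; exact Submodule.smul_mem _ _ hone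
    | k i => exact (kOp_mem_stabSub hV hq hk hx i).1
    | kInv i => exact (kOp_mem_stabSub hV hq hk hx i).2
    | d => exact absurd rfl hy
    | a i n hn =>
      have e : op T h V (Free.g (.a i n hn)) = aOp T h V i n := by
        rw [aOp, Free.a, dif_pos hn]
      rw [e]
      obtain ⟨t, rfl | rfl⟩ := Int.eq_nat_or_neg n
      · exact hpos i t (by omega)
      · exact hneg i t (by omega)
    | x ε i n => exact hx ε i n
  refine le_antisymm hW fun v hv => ?_
  -- Every nonempty creation monomial lands in the creation range, so a vacuum vector of `S = V`
  -- differs from an element of `W` by a vacuum vector in that range, hence by `0`.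
  have hle : S ≤ W ⊔ creationRange (aOp T h V) :=
    orbitSpan_le (fun y w _ => Submodule.mem_sup_right
      (apply_mem_creationRange _ _ (Nat.succ_pos _) w)) fun w hw => Submodule.mem_sup_left hw
  obtain ⟨w, hw, u, hu, rfl⟩ := Submodule.mem_sup.mp (hle (hStop ▸ Submodule.mem_top : v ∈ S))
  have hu' : u ∈ vacuumOf (aOp T h V) := by simpa using sub_mem hv (hW hw)
  rw [H.eq_zero_of_mem_vacuumOf_of_mem_creationRange hu' hu, add_zero]
  exact hw

/-- A nonzero subspace stable under the annihilation operators contains a nonzero vacuum vector. -/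
theorem inf_vacuum_ne_bot (hV : InCategory T h k V)
    (hq : ∀ n : ℕ, 0 < n → Complex.exp h ^ n ≠ 1) (hk : k ≠ 0) {S : Submodule ℂ V} (hS : S ≠ ⊥)
    (ha : ∀ i, ∀ n : ℕ, 0 < n → aOp T h V i n ∈ stabSub S) : S ⊓ vacuum T h k V ≠ ⊥ := by
  obtain ⟨M, v, hvS, hvM, hv0, hmin⟩ := hV.isTruncFiltration.exists_minimal hS
  refine (Submodule.ne_bot_iff _).mpr ⟨v, ⟨hvS, ?_⟩, hv0⟩
  rw [vacuum_eq_vacuumOf hq hk]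
  refine mem_vacuumOf.mpr fun i n hn => ?_
  exact hmin n (by omega) _ (ha i n hn v hvS) ((hV.isHeisenberg hq hk).deg i n _ _ hvM)

theorem zIrreducible_vacuum_of_isSimpleModule (hV : InCategory T h k V)
    (hq : ∀ n : ℕ, 0 < n → Complex.exp h ^ n ≠ 1) (hk : k ≠ 0) (hs : IsSimpleModule (Uq T h) V) :
    ZIrreducible T h k V (vacuum T h k V) where
  stable := zStable_vacuum hV hq hk
  ne_bot := by
    have : Nontrivial V := IsSimpleModule.nontrivial (Uq T h) V
    have := inf_vacuum_ne_bot hV hq hk (S := ⊤) top_ne_bot fun _ _ _ _ _ => Submodule.mem_top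
    rwa [top_inf_eq] at this
  eq_bot_or_eq W hW hWZ := or_iff_not_imp_left.mpr fun h0 =>
    eq_vacuum_of_zStable hV hq hk hW hWZ h0

/-- A submodule is stable under the coefficients of both exponentials, so its intersection with the
vacuum space is `Z`-stable. Being nonzero, it is the whole vacuum space, from which the creators
generate `V`. -/
theorem isSimpleModule_of_zIrreducible_vacuum (hV : InCategory T h k V)
    (hq : ∀ n : ℕ, 0 < n → Complex.exp h ^ n ≠ 1) (hk : k ≠ 0)
    (hΩ : ZIrreducible T h k V (vacuum T h k V)) : IsSimpleModule (Uq T h) V := by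
  have hnt : Nontrivial V := by
    obtain ⟨v, -, hv0⟩ := Submodule.exists_mem_ne_zero_of_ne_bot hΩ.ne_bot
    exact ⟨v, 0, hv0⟩
  have H := hV.isHeisenberg hq hk
  rw [isSimpleModule_iff]
  refine { exists_pair_ne := ⟨⊥, ⊤, bot_ne_top⟩, eq_bot_or_eq_top := fun N => ?_ }
  rw [or_iff_not_imp_left]
  intro hN
  set S : Submodule ℂ V := N.restrictScalars ℂ with hSdef
  have hop : ∀ u, op T h V u ∈ stabSub S := fun u v hv => N.smul_mem _ hv
  have hS0 : S ≠ ⊥ := fun h0 => hN (by simpa [hSdef] using h0)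
  have hone : (1 : Module.End ℂ V) ∈ stabSub S := fun v hv => hv
  have hstab : ZStable T h k V (S ⊓ vacuum T h k V) := by
    intro ε i n w hw
    refine ⟨?_, hΩ.stable ε i n w hw.2⟩
    rw [zOp_eq_dressSum]
    exact dressSum_mem
      (coeff_EMinus_mem (A := fun _ => stabSub S) hone mul_mem_stabSub ε i fun _ _ => hop _)
      (fun _ => hop _)
      (coeff_EPlus_mem (A := fun _ => stabSub S) hone mul_mem_stabSub ε 1 i fun _ _ => hop _) n hw.1
  have hinf : S ⊓ vacuum T h k V = vacuum T h k V :=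
    (hΩ.eq_bot_or_eq _ inf_le_right hstab).resolve_left
      (inf_vacuum_ne_bot hV hq hk hS0 fun _ _ _ => hop _)
  have htop : S = ⊤ := H.eq_top_of_vacuumOf_le (fun _ _ _ => hop _) (by
    rw [← vacuum_eq_vacuumOf hq hk (k := k), ← hinf]
    exact inf_le_left)
  simpa [hSdef] using htop

end ZOperators

end

end QuantumZ

theorem proposition2p4 (T : QuantumZ.DynkinType) (h : ℂ)
    (hq : ∀ n : ℕ, 0 < n → Complex.exp h ^ n ≠ 1) (k : ℚ) (hk : k ≠ 0)
    (V : Type*) [AddCommGroup V] [Module ℂ V] [Module (QuantumZ.Uq T h) V]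
    [IsScalarTower ℂ (QuantumZ.Uq T h) V] (hV : QuantumZ.InCategory T h k V) :
    (∀ (ε : ℤˣ) (i : Fin T.rank) (n : ℤ) (v : V),
        (Function.support (QuantumZ.ZTerm T h k ε i n v)).Finite) ∧
      QuantumZ.ZStable T h k V (QuantumZ.vacuum T h k V) ∧
      (IsSimpleModule (QuantumZ.Uq T h) V ↔
        QuantumZ.ZIrreducible T h k V (QuantumZ.vacuum T h k V)) :=
  ⟨QuantumZ.zTerm_support_finite hV, QuantumZ.zStable_vacuum hV hq hk,
    QuantumZ.zIrreducible_vacuum_of_isSimpleModule hV hq hk,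
    QuantumZ.isSimpleModule_of_zIrreducible_vacuum hV hq hk⟩
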